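/- All graphs are finite and simple. A leaf is a vertex of degree one; a vertex is deep if its degree is at least two and none of its neighbours is a leaf. For a graph $H$, the chromatic symmetric function is $\mathbf X_H=\sum_\kappa\prod_{v\in V(H)}x_{\kappa(v)}$, the sum over all proper colourings $\kappa:V(H)\to\mathbb N$. Let $\mathrm{St}_k$ be the star on $k$ vertices and, for a partition $\lambda=(\lambda_1,\dots,\lambda_\ell)$ of $n$, put $\mathfrak{st}_\lambda=\mathbf X_{\mathrm{St}_{\lambda_1}}\cdots\mathbf X_{\mathrm{St}_{\lambda_\ell}}$; these form the star-basis of the homogeneous symmetric functions of degree $n$ over $\mathbb Q$. Theorem. Let $G$ be a connected unicyclic graph on $n$ vertices, with cycle $C$ of size $c$. For each vertex $u$ of $C$, the rooted tree at $u$ is the connected component of $u$ in the graph obtained from $G$ by removing all the edges of $C$; it is non-trivial if it has more than one vertex. Suppose that exactly one of these rooted trees is non-trivial, and let $v$ be its root. Let $T'$ be the graph obtained from $G$ by deleting one of the two edges of $C$ incident to $v$, let $u_1,\dots,u_p$ be the deep vertices of $T'$, and let $d_i=\deg_{T'}(u_i)$. Then $\mathbf X_G$ has a unique expansion $\mathbf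 X_G=\sum_{\lambda\vdash n}c_\lambda\,\mathfrak{st}_\lambda$ with $c_\lambda\in\mathbb Q$. Let $\lambda_{\mathrm{lead}}$ be the smallest partition of $n$, in lexicographic order, with $c_{\lambda_{\mathrm{lead}}}\neq0$. 1. If $v$ is a sprout in $G$ (that is, $v$ is deep in $G$; it lies on $C$ and has degree at least three), then $v$ is a deep vertex of $T'$ and, numbering the deep vertices so that $u_1=v$, $$c_{\lambda_{\mathrm{lead}}}=(-1)^p\Bigl[(c-2)\prod_{i=1}^p(d_i-1)+\prod_{i=2}^p(d_i-1)\Bigr].$$ 2. If $v$ is not a sprout in $G$, then $$c_{\lambda_{\mathrm{lead}}}=(-1)^p(c-2)\prod_{i=1}^p(d_i-1).$$ -/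

import Mathlib

open Finset

namespace ChromSym

section Graph

variable {V : Type*} (G : SimpleGraph V)

/-- A subgraph of `G` that is a cycle: the subgraph traced out by a closed walk of `G` which
repeats no edge and no vertex except for its common start and end point
(in a simple graph such a walk has length at least three). -/
def IsCycleSubgraph (C : G.Subgraph) : Prop :=
  ∃ (u : V) (q : G.Walk u u), q.IsCycle ∧ q.toSubgraph = C

/-- `G` is a connected unicyclic graph, with `C` as its one and only cycle. -/
structure IsConnectedUnicyclic (C : G.Subgraph) : Prop where
  connected : G.Connected
  isCycle : IsCycleSubgraph G C
  unique : ∀ C' : G.Subgraph, IsCycleSubgraph G C' → C' = C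

/-- The vertex set of the rooted tree of `G` with root `u` on the cycle `C`: the vertices that can
be reached from `u` after all the edges of the cycle have been removed. -/
def rootedTree (C : G.Subgraph) (u : V) : Set V :=
  {x | (G.deleteEdges C.edgeSet).Reachable u x}

/-- The set of the roots (vertices of the cycle `C`) whose rooted tree is non-trivial,
that is, has more than one vertex. -/
def nontrivialRoots (C : G.Subgraph) : Set V :=
  {u | u ∈ C.verts ∧ (rootedTree G C u).Nontrivial}

variable [Fintype V] [DecidableRel G.Adj]

/-- A deep vertex: an internal vertex (degree at least two) that has no leaf (vertex of degree one)
as a neighbour. -/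
def IsDeep (u : V) : Prop :=
  2 ≤ G.degree u ∧ ∀ x, G.Adj u x → G.degree x ≠ 1

instance : DecidablePred (IsDeep G) := fun u =>
  inferInstanceAs (Decidable (2 ≤ G.degree u ∧ ∀ x, G.Adj u x → G.degree x ≠ 1))

/-- The finite set of all deep vertices. -/
def deepVertices : Finset V := univ.filter (IsDeep G)

/-- A sprout: a deep vertex on the cycle `C` of degree at least three. -/
def IsSprout (C : G.Subgraph) (u : V) : Prop :=
  u ∈ C.verts ∧ IsDeep G u ∧ 3 ≤ G.degree u

end Graph

section SymmetricFunctions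

/-- The chromatic symmetric function `∑ κ, ∏ v, x_(κ v)`, the sum over all proper colourings
`κ : V → ℕ`, as a formal power series in the variables `x₀, x₁, x₂, …`: the coefficient of the
monomial `x ^ d` is the (finite) number of proper colourings `κ` with `∏ v, x_(κ v) = x ^ d`. -/
noncomputable def csf {V : Type*} [Fintype V] (G : SimpleGraph V) : MvPowerSeries ℕ ℚ :=
  fun d => (Nat.card {κ : G.Coloring ℕ // ∑ v, Finsupp.single (κ v) 1 = d} : ℚ)

/-- The star graph on the `k` vertices `0, …, k - 1`, with centre `0`. -/
def starOn (k : ℕ) : SimpleGraph (Fin k) :=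
  SimpleGraph.fromRel fun i _ => (i : ℕ) = 0

/-- The star-basis element of a partition: the product of the chromatic symmetric functions of the
stars whose orders are the parts. -/
noncomputable def starBasis {n : ℕ} (μ : n.Partition) : MvPowerSeries ℕ ℚ :=
  (μ.parts.map fun k => csf (starOn k)).prod

/-- `c` is the family of coefficients of the expansion of the power series `f` in the
star-basis of degree `n`. -/
def IsStarExpansion {n : ℕ} (f : MvPowerSeries ℕ ℚ) (c : n.Partition → ℚ) : Prop :=
  f = ∑ μ : n.Partition, c μ • starBasis μ

/-- The parts of a partition in weakly decreasing order. -/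
def sortedParts {n : ℕ} (μ : n.Partition) : List ℕ := μ.parts.sort (· ≥ ·)

/-- `μ` is the leading partition of the family of coefficients `c`: the smallest partition, in
lexicographic order, whose coefficient is not zero. -/
def IsLeadingPartition {n : ℕ} (c : n.Partition → ℚ) (μ : n.Partition) : Prop :=
  c μ ≠ 0 ∧ ∀ ν : n.Partition, c ν ≠ 0 → ν = μ ∨ List.Lex (· < ·) (sortedParts μ) (sortedParts ν)

end SymmetricFunctions

end ChromSym

/-! Everything is computed in finitely many variables, with sum `p`, by deletion and contraction on
weighted graphs. A vertex of colour `i` has weight `x_i ^ b (p - x_i) ^ L`: it stands for `b` merged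
vertices with `L` leaves whose colours have been summed out. Summing out a leaf raises `L` at its
neighbour by one; contracting an edge adds the `b`s and the `L`s of its ends.

Without edges the sum is a product of factors `∑ x_i ^ b (p - x_i) ^ L`. The identity `x ^ (b+1) (p
- x) ^ L = p x ^ b (p - x) ^ L - x ^ b (p - x) ^ (L+1)` makes each factor a polynomial in the stars
with lexicographically lowest term `st_1 ^ (b-1) st_(L+1)`, so the lowest term is governed by `L`
alone. Merging two vertices with `L > 0` strictly raises it; merging when one of them has `L = 0`
does not. Hence all leading coefficients follow from a recursion on the edges. The lexicographic
order is encoded in one exponent by giving `st_(k+1)` the weight `B ^ k - 1`, with `B` large.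

Strip all leaves of `G`. What remains is the cycle with a tree grown at `v`. Attaching vertices one
at a time (`LeafExt.hasStarLead`), each vertex off the cycle with `L = 0` contributes `1 - deg`;
these vertices are the deep ones, up to isolated vertices contributing 1. The cycle is settled by
opening its last edge (`hasStarLead_pathOn`, `hasStarLead_cycleOn`). The cycle contributes `A = (-1)
^ (c-3) (c-2)` if `v` carries a leaf, and `(-1) ^ (c-2) - A (deg v - 2)` otherwise.

In `T'` the remaining deep vertices on the cycle, apart possibly from `v`, number `c - 3` and have
degree two, so that the product over the deep vertices of `T'` reproduces these factors
(`prod_deepVertices`). The coefficient found is non-zero, hence really leading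
(`HasStarLead.exists_expansion`), and the expansion is unique because the stars are algebraically
independent (`starHom_injective`). -/

namespace ChromSym

set_option linter.unusedSectionVars false

/-! ### Weighted sums over proper colourings; deletion and contraction. -/

section ColorSum

/-- The colouring `κ` of the vertices is proper on `H`. -/
def IsProper {V ι : Type*} (H : SimpleGraph V) (κ : V → ι) : Prop :=
  ∀ u w, H.Adj u w → κ u ≠ κ w

open scoped Classical in
/-- The sum, over all colourings `κ` of the vertices that are proper on `H`, of the products of the
vertex weights `g u (κ u)`. -/
noncomputable def colorSum {V ι R : Type*} [Fintype V] [DecidableEq V] [Fintype ι] [CommRing R]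
    (H : SimpleGraph V) (g : V → ι → R) : R :=
  ∑ κ : V → ι, if IsProper H κ then ∏ u, g u (κ u) else 0

variable {V ι R : Type*} [Fintype V] [DecidableEq V] [Fintype ι] [CommRing R]

/-- Fubini in the colour of `ℓ`. The factor `δ` of total mass one keeps the summed-out vertex in the
type `V`, so contraction never changes the vertex set. -/
lemma sum_mul_eq_sum_mul_sum {ℓ w : V} (hne : ℓ ≠ w) (A : (V → ι) → R)
    (hA : ∀ κ i, A (Function.update κ ℓ i) = A κ) (B : ι → ι → R) (δ : ι → R)
    (hδ : ∑ i, δ i = 1) :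
    ∑ κ, A κ * B (κ w) (κ ℓ) = ∑ κ, A κ * (∑ i, B (κ w) i) * δ (κ ℓ) := by
  have key : ∀ B : ι → ι → R, ∑ κ, A κ * B (κ w) (κ ℓ) =
      ∑ f : {u // u ≠ ℓ} → ι, ∑ i : ι,
        A ((Equiv.funSplitAt ℓ ι).symm (i, f)) * B (f ⟨w, hne.symm⟩) i := by
    intro B
    rw [← (Equiv.funSplitAt ℓ ι).symm.sum_comp, Fintype.sum_prod_type, Finset.sum_comm]
    refine Finset.sum_congr rfl fun f _ => Finset.sum_congr rfl fun i _ => ?_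
    simp [Equiv.funSplitAt, Equiv.piSplitAt, hne.symm]
  have hA' : ∀ f i j, A ((Equiv.funSplitAt ℓ ι).symm (i, f)) =
      A ((Equiv.funSplitAt ℓ ι).symm (j, f)) := by
    intro f i j
    rw [← hA _ j]
    congr 1
    ext u
    by_cases h : u = ℓ
    · subst h; simp [Equiv.funSplitAt, Equiv.piSplitAt]
    · simp [Equiv.funSplitAt, Equiv.piSplitAt, h]
  rw [key B]
  simp_rw [mul_assoc]
  rw [key fun a j => (∑ i, B a i) * δ j]
  refine Finset.sum_congr rfl fun f _ => ?_
  rcases isEmpty_or_nonempty ι with h | ⟨⟨j⟩⟩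
  · simp
  · simp_rw [fun i => hA' f i j]
    rw [← Finset.mul_sum, ← Finset.mul_sum, ← Finset.mul_sum, hδ, mul_one]

lemma prod_update_update {ℓ w : V} (hne : ℓ ≠ w) (g : V → ι → R) (h₁ h₂ : ι → R) (κ : V → ι) :
    ∏ u, Function.update (Function.update g w h₁) ℓ h₂ u (κ u) =
      (∏ u ∈ (univ.erase ℓ).erase w, g u (κ u)) * h₁ (κ w) * h₂ (κ ℓ) := by
  rw [← Finset.mul_prod_erase univ _ (mem_univ ℓ),
    ← Finset.mul_prod_erase (univ.erase ℓ) _ (mem_erase.2 ⟨hne.symm, mem_univ w⟩)]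
  simp only [Function.update_self, Function.update_of_ne hne.symm]
  rw [Finset.prod_congr rfl (g := fun u => g u (κ u))]
  · ring
  · intro u hu
    simp only [mem_erase] at hu
    rw [Function.update_of_ne hu.2.1, Function.update_of_ne hu.1]

lemma proper_sup_edge {H : SimpleGraph V} {ℓ w : V} (hne : ℓ ≠ w) (κ : V → ι) :
    IsProper (H ⊔ SimpleGraph.edge ℓ w) κ ↔ IsProper H κ ∧ κ ℓ ≠ κ w := by
  simp only [IsProper, SimpleGraph.sup_adj, SimpleGraph.edge_adj]
  constructor
  · exact fun h => ⟨fun u x hu => h u x (Or.inl hu), h ℓ w (Or.inr ⟨Or.inl ⟨rfl, rfl⟩, hne⟩)⟩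
  · rintro ⟨h₁, h₂⟩ u x (h | ⟨⟨rfl, rfl⟩ | ⟨rfl, rfl⟩, -⟩)
    exacts [h₁ u x h, h₂, h₂.symm]

lemma proper_update_iff {H : SimpleGraph V} {ℓ : V} (hiso : ∀ x, ¬ H.Adj ℓ x) (κ : V → ι) (i : ι) :
    IsProper H (Function.update κ ℓ i) ↔ IsProper H κ := by
  refine forall_congr' fun u => forall_congr' fun x => ?_
  refine imp_congr_right fun h => ?_
  have hu : u ≠ ℓ := fun e => hiso x (e ▸ h)
  have hx : x ≠ ℓ := fun e => hiso u (e ▸ h.symm)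
  rw [Function.update_of_ne hu, Function.update_of_ne hx]

open scoped Classical in
/-- Sum out the colour of a vertex `ℓ` that is isolated in `H` and interacts with `w` only. -/
lemma sum_proper_mul {H : SimpleGraph V} {ℓ w : V} (hne : ℓ ≠ w) (hiso : ∀ x, ¬ H.Adj ℓ x)
    (g : V → ι → R) (δ : ι → R) (hδ : ∑ i, δ i = 1) (P : ι → ι → Prop)
    [∀ i j, Decidable (P i j)] :
    ∑ κ : V → ι, (if IsProper H κ ∧ P (κ w) (κ ℓ)
        then ∏ u, g u (κ u) else 0) =
      colorSum H (Function.update (Function.update g w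
        (fun i => g w i * ∑ j, if P i j then g ℓ j else 0)) ℓ δ) := by
  have h := sum_mul_eq_sum_mul_sum hne
    (fun κ : V → ι => if IsProper H κ then
      (∏ u ∈ (univ.erase ℓ).erase w, g u (κ u)) * g w (κ w) else 0) ?_
    (fun i j => if P i j then g ℓ j else 0) δ hδ
  · rw [colorSum]
    simp only [prod_update_update hne]
    refine Eq.trans ?_ (h.trans ?_)
    · refine Finset.sum_congr rfl fun κ _ => ?_
      have e := prod_update_update hne g (g w) (g ℓ) κ
      rw [Function.update_eq_self, Function.update_eq_self] at e
      rw [e]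
      split_ifs <;> simp_all
    · refine Finset.sum_congr rfl fun κ _ => ?_
      split_ifs
      · ring
      · simp
  · intro κ i
    simp only [proper_update_iff hiso, Function.update_of_ne hne.symm]
    congr 2
    refine Finset.prod_congr rfl fun u hu => ?_
    simp only [mem_erase] at hu
    rw [Function.update_of_ne hu.2.1]

/-- Deletion and contraction of the edge between `ℓ` and `w`. -/
lemma colorSum_sup_edge {H H' : SimpleGraph V} {ℓ w : V} (hne : ℓ ≠ w) (hiso : ∀ x, ¬ H'.Adj ℓ x)
    (hH : ∀ κ : V → ι, κ ℓ = κ w →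
      (IsProper H κ ↔ IsProper H' κ))
    (g : V → ι → R) (δ : ι → R) (hδ : ∑ i, δ i = 1) :
    colorSum (H ⊔ SimpleGraph.edge ℓ w) g = colorSum H g -
      colorSum H' (Function.update (Function.update g w (g w * g ℓ)) ℓ δ) := by
  classical
  have h := sum_proper_mul hne hiso g δ hδ (fun i j => j = i)
  simp only [Finset.sum_ite_eq', mem_univ, if_true] at h
  change _ = colorSum H' (Function.update (Function.update g w (g w * g ℓ)) ℓ δ) at h
  rw [← h, colorSum, colorSum, ← Finset.sum_sub_distrib]
  refine Finset.sum_congr rfl fun κ _ => ?_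
  simp only [proper_sup_edge hne]
  by_cases hκ : κ ℓ = κ w
  · simp [hκ, hH κ hκ]
  · simp [hκ]

/-- Sum out the colour of a leaf `ℓ` attached at `w`. -/
lemma colorSum_sup_edge_leaf {H : SimpleGraph V} {ℓ w : V} (hne : ℓ ≠ w) (hiso : ∀ x, ¬ H.Adj ℓ x)
    (g : V → ι → R) (δ : ι → R) (hδ : ∑ i, δ i = 1) :
    colorSum (H ⊔ SimpleGraph.edge ℓ w) g = colorSum H
      (Function.update (Function.update g w (fun i => g w i * (∑ j, g ℓ j - g ℓ i))) ℓ δ) := by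
  classical
  have h := sum_proper_mul hne hiso g δ hδ (fun i j => j ≠ i)
  have e : ∀ i, (∑ j, if j ≠ i then g ℓ j else 0) = ∑ j, g ℓ j - g ℓ i := by
    intro i
    rw [← Finset.sum_filter, Finset.filter_ne', ← Finset.add_sum_erase univ _ (mem_univ i)]
    ring
  simp only [e] at h
  rw [← h, colorSum]
  simp only [proper_sup_edge hne]

lemma colorSum_bot (g : V → ι → R) : colorSum ⊥ g = ∏ u, ∑ i, g u i := by
  simp [colorSum, IsProper, Finset.prod_univ_sum]

end ColorSum

/-! ### The vertex weights `x ^ b (p - x) ^ L`. -/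

section Weights

variable {V R : Type*} [Fintype V] [DecidableEq V] [CommRing R] {N : ℕ}

/-- The vertex weight `x_i ^ b (p - x_i) ^ L`, where `p` is the sum of all variables; a vertex with
`b = 0` is a vertex that has been removed, with weights of sum one. -/
def vertexWeight (x : Fin (N + 1) → R) (b L : V → ℕ) (u : V) (i : Fin (N + 1)) : R :=
  if b u = 0 then (if i = 0 then 1 else 0) else x i ^ b u * (∑ j, x j - x i) ^ L u

lemma vertexWeight_merge (x : Fin (N + 1) → R) {b L : V → ℕ} {ℓ w : V} (hne : ℓ ≠ w)
    (hℓ : 0 < b ℓ) (hw : 0 < b w) :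
    Function.update (Function.update (vertexWeight x b L) w
      (vertexWeight x b L w * vertexWeight x b L ℓ)) ℓ (fun i => if i = 0 then 1 else 0) =
    vertexWeight x (Function.update (Function.update b w (b w + b ℓ)) ℓ 0)
      (Function.update (Function.update L w (L w + L ℓ)) ℓ 0) := by
  funext u i
  by_cases hu : u = ℓ
  · subst hu; simp [vertexWeight]
  by_cases hu' : u = w
  · subst hu'
    simp only [Function.update_of_ne hu, Function.update_self, vertexWeight, Pi.mul_apply]
    rw [if_neg hw.ne', if_neg hℓ.ne', if_neg (by omega)]
    ring
  · simp [vertexWeight, Function.update_of_ne hu, Function.update_of_ne hu']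

lemma vertexWeight_leaf (x : Fin (N + 1) → R) {b L : V → ℕ} {ℓ w : V} (hne : ℓ ≠ w)
    (hℓ : b ℓ = 1) (hL : L ℓ = 0) (hw : 0 < b w) :
    Function.update (Function.update (vertexWeight x b L) w
      (fun i => vertexWeight x b L w i * (∑ j, vertexWeight x b L ℓ j - vertexWeight x b L ℓ i))) ℓ
        (fun i => if i = 0 then 1 else 0) =
    vertexWeight x (Function.update b ℓ 0) (Function.update L w (L w + 1)) := by
  funext u i
  by_cases hu : u = ℓ
  · subst hu; simp [vertexWeight]
  by_cases hu' : u = w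
  · subst hu'
    simp only [Function.update_of_ne hu, Function.update_self, vertexWeight, hℓ, hL]
    rw [if_neg hw.ne']
    simp only [one_ne_zero, if_false, pow_one, pow_zero, mul_one, if_neg hw.ne']
    ring
  · simp [vertexWeight, Function.update_of_ne hu, Function.update_of_ne hu']

lemma colorSum_weight_sup_edge (x : Fin (N + 1) → R) {H H' : SimpleGraph V} {ℓ w : V} (hne : ℓ ≠ w)
    (hiso : ∀ x, ¬ H'.Adj ℓ x)
    (hH : ∀ κ : V → Fin (N + 1), κ ℓ = κ w →
      (IsProper H κ ↔ IsProper H' κ))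
    {b L : V → ℕ} (hℓ : 0 < b ℓ) (hw : 0 < b w) :
    colorSum (H ⊔ SimpleGraph.edge ℓ w) (vertexWeight x b L) = colorSum H (vertexWeight x b L) -
      colorSum H' (vertexWeight x (Function.update (Function.update b w (b w + b ℓ)) ℓ 0)
        (Function.update (Function.update L w (L w + L ℓ)) ℓ 0)) := by
  rw [colorSum_sup_edge hne hiso hH _ (fun i => if i = 0 then 1 else 0) (by simp),
    vertexWeight_merge x hne hℓ hw]

lemma colorSum_weight_sup_edge_leaf (x : Fin (N + 1) → R) {H : SimpleGraph V} {ℓ w : V}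
    (hne : ℓ ≠ w) (hiso : ∀ x, ¬ H.Adj ℓ x) {b L : V → ℕ}
    (hℓ : b ℓ = 1) (hL : L ℓ = 0) (hw : 0 < b w) :
    colorSum (H ⊔ SimpleGraph.edge ℓ w) (vertexWeight x b L) =
      colorSum H (vertexWeight x (Function.update b ℓ 0) (Function.update L w (L w + 1))) := by
  rw [colorSum_sup_edge_leaf hne hiso _ (fun i => if i = 0 then 1 else 0) (by simp),
    vertexWeight_leaf x hne hℓ hL hw]

end Weights

/-! ### Leading terms in the stars. -/

section StarLead

open MvPolynomial

/-- The chromatic symmetric function of the star on `k + 1` vertices, in `N + 1` variables. -/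
noncomputable def starPoly (N k : ℕ) : MvPolynomial (Fin (N + 1)) ℚ :=
  ∑ i, X i * (∑ j, X j - X i) ^ k

/-- The exponents encoding the lexicographic order on partitions. -/
def lexWeight (B k : ℕ) : ℕ := B ^ k - 1

/-- The substitution `e_k ↦ t ^ (lexWeight B k)`. -/
noncomputable def lexEval (B : ℕ) : MvPolynomial ℕ ℚ →ₐ[ℚ] Polynomial ℚ :=
  aeval fun k => Polynomial.X ^ lexWeight B k

/-- `F` is homogeneous of degree `n` in the stars, and its lexicographically lowest possible term
is the one of weight `m`, with coefficient `α` (which may vanish). -/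
def HasStarLead (B n : ℕ) (F : ∀ N, MvPolynomial (Fin (N + 1)) ℚ) (m : ℕ) (α : ℚ) : Prop :=
  ∃ Φ : MvPolynomial ℕ ℚ, Φ.IsWeightedHomogeneous (fun k => k + 1) n ∧
    (∀ N, aeval (starPoly N) Φ = F N) ∧
    ∃ r, lexEval B Φ = Polynomial.C α * Polynomial.X ^ m + Polynomial.X ^ (m + 1) * r

lemma lexWeight_zero (B : ℕ) : lexWeight B 0 = 0 := by simp [lexWeight]

lemma lexWeight_strictMono {B : ℕ} (hB : 2 ≤ B) : StrictMono (lexWeight B) := by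
  intro i j h
  have h1 := Nat.pow_lt_pow_right (a := B) (by omega) h
  have h2 : 0 < B ^ i := by positivity
  simp only [lexWeight]
  omega

/-- This strict superadditivity is why contracting an edge between two vertices that both carry
leaves does not affect the leading term. -/
lemma lexWeight_add_lt {B : ℕ} (hB : 2 ≤ B) {i j : ℕ} (hi : 0 < i) (hj : 0 < j) :
    lexWeight B i + lexWeight B j < lexWeight B (i + j) := by
  have h1 : 2 ≤ B ^ i := hB.trans (Nat.le_self_pow hi.ne' B)
  have h2 : 2 ≤ B ^ j := hB.trans (Nat.le_self_pow hj.ne' B)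
  simp only [lexWeight, pow_add]
  obtain ⟨a, ha⟩ := Nat.exists_eq_add_of_le h1
  obtain ⟨b, hb⟩ := Nat.exists_eq_add_of_le h2
  rw [ha, hb]
  have : (2 + a) * (2 + b) = 4 + 2 * a + 2 * b + a * b := by ring
  rw [this]
  have : 0 ≤ a * b := Nat.zero_le _
  omega

variable {B n n' m m' : ℕ} {F F' : ∀ N, MvPolynomial (Fin (N + 1)) ℚ} {α α' : ℚ}

lemma HasStarLead.congr (h : HasStarLead B n F m α) (hn : n = n') (hF : ∀ N, F N = F' N)
    (hm : m = m') (hα : α = α') : HasStarLead B n' F' m' α' := by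
  obtain rfl : F = F' := funext hF
  subst hn hm hα
  exact h

lemma HasStarLead.weaken (h : HasStarLead B n F m α) (hm : m' < m) : HasStarLead B n F m' 0 := by
  obtain ⟨Φ, h1, h2, r, h3⟩ := h
  obtain ⟨d, rfl⟩ := Nat.exists_eq_add_of_lt hm
  refine ⟨Φ, h1, h2, Polynomial.X ^ d * (Polynomial.C α + Polynomial.X * r), ?_⟩
  rw [h3, Polynomial.C_0]
  ring

lemma HasStarLead.sub (h : HasStarLead B n F m α) (h' : HasStarLead B n F' m α') :
    HasStarLead B n (fun N => F N - F' N) m (α - α') := by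
  obtain ⟨Φ, h1, h2, r, h3⟩ := h
  obtain ⟨Φ', h1', h2', r', h3'⟩ := h'
  refine ⟨Φ - Φ', h1.sub h1', fun N => by rw [map_sub, h2, h2'], r - r', ?_⟩
  rw [map_sub, h3, h3', Polynomial.C_sub]
  ring

lemma HasStarLead.mul (h : HasStarLead B n F m α) (h' : HasStarLead B n' F' m' α') :
    HasStarLead B (n + n') (fun N => F N * F' N) (m + m') (α * α') := by
  obtain ⟨Φ, h1, h2, r, h3⟩ := h
  obtain ⟨Φ', h1', h2', r', h3'⟩ := h'
  refine ⟨Φ * Φ', h1.mul h1', fun N => by rw [map_mul, h2, h2'],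
    Polynomial.C α * r' + r * Polynomial.C α' + Polynomial.X * (r * r'), ?_⟩
  rw [map_mul, h3, h3', Polynomial.C_mul]
  ring

lemma hasStarLead_one : HasStarLead B 0 (fun _ => 1) 0 1 :=
  ⟨1, isWeightedHomogeneous_one _ _, by simp, 0, by simp⟩

lemma HasStarLead.prod {ι : Type*} (s : Finset ι) {n m : ι → ℕ}
    {F : ι → ∀ N, MvPolynomial (Fin (N + 1)) ℚ} (h : ∀ i ∈ s, HasStarLead B (n i) (F i) (m i) 1) :
    HasStarLead B (∑ i ∈ s, n i) (fun N => ∏ i ∈ s, F i N) (∑ i ∈ s, m i) 1 := by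
  classical
  induction s using Finset.induction_on with
  | empty => simpa using hasStarLead_one
  | insert a s ha ih =>
    simp only [Finset.sum_insert ha, Finset.prod_insert ha]
    have h' := (h a (mem_insert_self a s)).mul (ih fun i hi => h i (mem_insert_of_mem hi))
    rwa [one_mul] at h'

lemma hasStarLead_starPoly (k : ℕ) :
    HasStarLead B (k + 1) (fun N => starPoly N k) (lexWeight B k) 1 :=
  ⟨X k, isWeightedHomogeneous_X _ _ _, by simp, 0, by simp [lexEval]⟩

/-- Induction on `b` by `x ^ (b+2) (p - x) ^ L = p x ^ (b+1) (p - x) ^ L - x ^ (b+1) (p - x) ^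
(L+1)`. The factor `p` is the one-vertex star, of weight zero, and the subtracted term starts
strictly higher. -/
lemma hasStarLead_sum_pow_mul_pow (hB : 2 ≤ B) (b L : ℕ) :
    HasStarLead B (b + 1 + L)
      (fun N => ∑ i : Fin (N + 1), X i ^ (b + 1) * (∑ j, X j - X i) ^ L) (lexWeight B L) 1 := by
  induction b generalizing L with
  | zero => simpa [starPoly, add_comm] using hasStarLead_starPoly L
  | succ b ih =>
    have h1 := (hasStarLead_starPoly (B := B) 0).mul (ih L)
    have h2 := (ih (L + 1)).weaken (lexWeight_strictMono hB (Nat.lt_succ_self L))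
    refine ((h1.congr (n' := b + 1 + 1 + L) (by ring) (fun _ => rfl)
      (by rw [lexWeight_zero, zero_add]) (one_mul _)).sub
      (h2.congr (by ring) (fun _ => rfl) rfl rfl)).congr rfl (fun N => ?_) rfl (sub_zero _)
    simp only [starPoly, pow_zero, mul_one]
    rw [Finset.mul_sum, ← Finset.sum_sub_distrib]
    refine Finset.sum_congr rfl fun i _ => ?_
    ring

variable {V : Type*} [Fintype V] [DecidableEq V]

/-- The weighted colouring sums of a graph, in the polynomial rings in `N + 1` variables. -/
noncomputable def weightedSum (H : SimpleGraph V) (b L : V → ℕ) (N : ℕ) :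
    MvPolynomial (Fin (N + 1)) ℚ :=
  colorSum H (vertexWeight X b L)

lemma hasStarLead_weightedSum_bot (hB : 2 ≤ B) {b L : V → ℕ} (hbL : ∀ u, b u = 0 → L u = 0) :
    HasStarLead B (∑ u, (b u + L u)) (weightedSum ⊥ b L) (∑ u, lexWeight B (L u)) 1 := by
  have h : weightedSum ⊥ b L = fun N => ∏ u, ∑ i : Fin (N + 1), vertexWeight X b L u i := by
    funext N
    exact colorSum_bot _
  rw [h]
  refine HasStarLead.prod univ fun u _ => ?_
  rcases Nat.eq_zero_or_pos (b u) with hb | hb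
  · simpa [vertexWeight, hb, hbL u hb, lexWeight_zero] using hasStarLead_one
  · obtain ⟨k, hk⟩ := Nat.exists_eq_succ_of_ne_zero hb.ne'
    simpa [vertexWeight, hk] using hasStarLead_sum_pow_mul_pow hB k (L u)

end StarLead

/-! ### Growing a tree on a core graph. -/

section LeafExtension

variable {V : Type*} [Fintype V] [DecidableEq V]

/-- The number of neighbours of a vertex. -/
noncomputable def nbrCount (H : SimpleGraph V) (u : V) : ℕ := (H.neighborSet u).ncard

lemma nbrCount_eq_degree (H : SimpleGraph V) (u : V) [Fintype (H.neighborSet u)] :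
    nbrCount H u = H.degree u := by
  rw [nbrCount, Set.ncard_eq_toFinset_card', Set.toFinset_card,
    SimpleGraph.card_neighborSet_eq_degree]

lemma nbrCount_eq_zero {H : SimpleGraph V} {u : V} (h : ∀ x, ¬ H.Adj u x) : nbrCount H u = 0 := by
  rw [nbrCount, Set.ncard_eq_zero]
  ext x
  simp [h x]

lemma nbrCount_sup_edge {H : SimpleGraph V} {ℓ w : V} (hne : ℓ ≠ w) (hiso : ∀ x, ¬ H.Adj ℓ x)
    (u : V) : nbrCount (H ⊔ SimpleGraph.edge ℓ w) u =
      nbrCount H u + if u = ℓ ∨ u = w then 1 else 0 := by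
  by_cases h1 : u = ℓ
  · subst h1
    have : (H ⊔ SimpleGraph.edge u w).neighborSet u = {w} := by
      ext x
      simp only [SimpleGraph.mem_neighborSet, SimpleGraph.sup_adj, hiso, SimpleGraph.edge_adj,
        Set.mem_singleton_iff]
      constructor
      · rintro (h | ⟨⟨-, h⟩ | ⟨h, -⟩, -⟩)
        exacts [h.elim, h, (hne h).elim]
      · rintro rfl
        simp [hne]
    rw [nbrCount, this, Set.ncard_singleton, nbrCount_eq_zero hiso]
    simp
  by_cases h2 : u = w
  · subst h2
    have : (H ⊔ SimpleGraph.edge ℓ u).neighborSet u = insert ℓ (H.neighborSet u) := by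
      ext x
      simp only [SimpleGraph.mem_neighborSet, SimpleGraph.sup_adj, SimpleGraph.edge_adj,
        Set.mem_insert_iff]
      constructor
      · rintro (h | ⟨⟨h, -⟩ | ⟨-, h⟩, -⟩)
        exacts [Or.inr h, (h1 h).elim, Or.inl h]
      · rintro (rfl | h)
        · simp [h1]
        · exact Or.inl h
    have hn : ℓ ∉ H.neighborSet u := fun h => hiso u (SimpleGraph.Adj.symm h)
    rw [nbrCount, this, Set.ncard_insert_of_notMem hn, nbrCount]
    simp
  · have : (H ⊔ SimpleGraph.edge ℓ w).neighborSet u = H.neighborSet u := by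
      ext x
      simp [SimpleGraph.edge_adj, h1, h2]
    rw [nbrCount, this, nbrCount]
    simp [h1, h2]

lemma sum_comp_update_update {ℓ w : V} (hne : ℓ ≠ w) (L : V → ℕ) (φ : ℕ → ℕ) (c d : ℕ) :
    ∑ u, φ (Function.update (Function.update L w c) ℓ d u) + (φ (L w) + φ (L ℓ)) =
      ∑ u, φ (L u) + (φ c + φ d) := by
  have hw : w ∈ univ.erase ℓ := mem_erase.2 ⟨hne.symm, mem_univ w⟩
  rw [← Finset.add_sum_erase univ _ (mem_univ ℓ), ← Finset.add_sum_erase _ _ hw,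
    ← Finset.add_sum_erase univ (fun u => φ (L u)) (mem_univ ℓ), ← Finset.add_sum_erase _ _ hw,
    Finset.sum_congr rfl (g := fun u => φ (L u))]
  · simp only [Function.update_self, Function.update_of_ne hne.symm]
    ring
  · intro u hu
    simp only [mem_erase] at hu
    rw [Function.update_of_ne hu.2.1, Function.update_of_ne hu.1]

lemma sum_merge {ℓ w : V} (hne : ℓ ≠ w) (b L : V → ℕ) :
    ∑ u, (Function.update (Function.update b w (b w + b ℓ)) ℓ 0 u +
      Function.update (Function.update L w (L w + L ℓ)) ℓ 0 u) = ∑ u, (b u + L u) := by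
  have h1 := sum_comp_update_update hne b id (b w + b ℓ) 0
  have h2 := sum_comp_update_update hne L id (L w + L ℓ) 0
  simp only [id] at h1 h2
  rw [Finset.sum_add_distrib, Finset.sum_add_distrib]
  omega

lemma sum_leaf {ℓ w : V} (hne : ℓ ≠ w) {b L : V → ℕ} (hb : b ℓ = 1) :
    ∑ u, (Function.update b ℓ 0 u + Function.update L w (L w + 1) u) = ∑ u, (b u + L u) := by
  have h1 := sum_comp_update_update hne b id (b w) 0
  have h2 := sum_comp_update_update hne L id (L w + 1) (L ℓ)
  have e : Function.update (Function.update L w (L w + 1)) ℓ (L ℓ) =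
      Function.update L w (L w + 1) := by
    rw [Function.update_eq_self_iff, Function.update_of_ne hne]
  simp only [id, Function.update_eq_self, e] at h1 h2
  rw [Finset.sum_add_distrib, Finset.sum_add_distrib]
  omega

/-- The graphs obtained from `K` by repeatedly attaching an isolated vertex outside of `S` to
`v` or to another vertex outside of `S`. -/
inductive LeafExt (K : SimpleGraph V) (S : Finset V) (v : V) : SimpleGraph V → Prop
  | core : LeafExt K S v K
  | attach {H : SimpleGraph V} {ℓ w : V} : LeafExt K S v H → ℓ ≠ w → ℓ ∉ S → (w ∈ S → w = v) →
      (∀ x, ¬ H.Adj ℓ x) → LeafExt K S v (H ⊔ SimpleGraph.edge ℓ w)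

/-- Vertex weights for which no vertex of `S` has been removed, and all vertices of `S` but `v`
still have their original weight. -/
structure Admissible (S : Finset V) (v : V) (b L : V → ℕ) : Prop where
  ne_zero : ∀ u ∈ S, b u ≠ 0
  original : ∀ u ∈ S, u ≠ v → b u = 1 ∧ L u = 0
  removed : ∀ u, b u = 0 → L u = 0

/-- The contribution of a vertex outside of `S` to the leading coefficient. -/
noncomputable def leadFactor (S : Finset V) (H : SimpleGraph V) (L : V → ℕ) (u : V) : ℚ :=
  if u ∉ S ∧ L u = 0 then 1 - (nbrCount H u : ℚ) else 1

lemma prod_split {ℓ w : V} (hne : ℓ ≠ w) (f : V → ℚ) :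
    ∏ u, f u = f ℓ * f w * ∏ u ∈ (univ.erase ℓ).erase w, f u := by
  rw [← Finset.mul_prod_erase univ _ (mem_univ ℓ),
    ← Finset.mul_prod_erase (univ.erase ℓ) _ (mem_erase.2 ⟨hne.symm, mem_univ w⟩), mul_assoc]

variable {B : ℕ} {K : SimpleGraph V} {S : Finset V} {v : V} {m₀ : ℕ} {A E : ℚ}

/-- Here `E` and `A` are the coefficients of the core when `v` has `L v = 0` and `L v ≠ 0`
respectively. The statement must hold for all admissible weights at once, since contracting the
newest edge `ℓw` returns to the smaller graph with changed `b` and `L`. Each such contraction into a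
leafless `w` makes it carry leaves: it subtracts 1 from the factor of `w`, or `A` from the core
coefficient if `w = v`. -/
theorem LeafExt.hasStarLead (hB : 2 ≤ B) (hv : v ∈ S) (hK : ∀ u ∉ S, ∀ x, ¬ K.Adj u x)
    (hcore : ∀ b L, Admissible S v b L →
      HasStarLead B (∑ u, (b u + L u)) (weightedSum K b L) (∑ u, lexWeight B (L u) + m₀)
        (if L v = 0 then E else A))
    {H : SimpleGraph V} (hH : LeafExt K S v H) {b L : V → ℕ} (hbL : Admissible S v b L)
    (hb : ∀ u x, H.Adj u x → b u ≠ 0) :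
    HasStarLead B (∑ u, (b u + L u)) (weightedSum H b L) (∑ u, lexWeight B (L u) + m₀)
      ((if L v = 0 then E - A * ((nbrCount H v : ℚ) - nbrCount K v) else A) *
        ∏ u, leadFactor S H L u) := by
  induction hH generalizing b L with
  | core =>
    rw [Finset.prod_eq_one, mul_one, sub_self, mul_zero, sub_zero]
    · exact hcore b L hbL
    · intro u _
      rw [leadFactor]
      split_ifs with h
      · rw [nbrCount_eq_zero (hK u h.1), Nat.cast_zero, sub_zero]
      · rfl
  | @attach H ℓ w hH hne hℓ hw hiso ih =>
    have hadj : (H ⊔ SimpleGraph.edge ℓ w).Adj ℓ w :=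
      Or.inr ((SimpleGraph.edge_adj ..).2 ⟨Or.inl ⟨rfl, rfl⟩, hne⟩)
    have hbℓ := hb ℓ w hadj
    have hbw := hb w ℓ hadj.symm
    have hvℓ : v ≠ ℓ := fun h => hℓ (h ▸ hv)
    set b' := Function.update (Function.update b w (b w + b ℓ)) ℓ 0 with hb'
    set L' := Function.update (Function.update L w (L w + L ℓ)) ℓ 0 with hL'
    have hb'u : ∀ u, u ≠ ℓ → u ≠ w → b' u = b u := fun u h1 h2 => by
      rw [hb', Function.update_of_ne h1, Function.update_of_ne h2]
    have hL'u : ∀ u, u ≠ ℓ → u ≠ w → L' u = L u := fun u h1 h2 => by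
      rw [hL', Function.update_of_ne h1, Function.update_of_ne h2]
    have hb'w : b' w = b w + b ℓ := by rw [hb', Function.update_of_ne hne.symm, Function.update_self]
    have hL'w : L' w = L w + L ℓ := by rw [hL', Function.update_of_ne hne.symm, Function.update_self]
    have hb'ℓ : b' ℓ = 0 := by rw [hb', Function.update_self]
    have hL'ℓ : L' ℓ = 0 := by rw [hL', Function.update_self]
    have hbL' : Admissible S v b' L' := by
      refine ⟨fun u hu => ?_, fun u hu huv => ?_, fun u hu => ?_⟩
      · have h1 : u ≠ ℓ := fun h => hℓ (h ▸ hu)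
        by_cases h2 : u = w
        · subst h2; omega
        · rw [hb'u u h1 h2]; exact hbL.ne_zero u hu
      · have h1 : u ≠ ℓ := fun h => hℓ (h ▸ hu)
        have h2 : u ≠ w := fun h => huv ((hw (h ▸ hu)) ▸ h)
        rw [hb'u u h1 h2, hL'u u h1 h2]
        exact hbL.original u hu huv
      · by_cases h1 : u = ℓ
        · rw [h1, hL'ℓ]
        by_cases h2 : u = w
        · subst h2; omega
        · rw [hL'u u h1 h2]
          exact hbL.removed u (by rwa [hb'u u h1 h2] at hu)
    have ih1 := ih hbL fun u x h => hb u x (Or.inl h)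
    have ih2 := ih hbL' fun u x h => by
      have h1 : u ≠ ℓ := fun e => hiso x (e ▸ h)
      by_cases h2 : u = w
      · subst h2; omega
      · rw [hb'u u h1 h2]; exact hb u x (Or.inl h)
    rw [sum_merge hne b L] at ih2
    have hF : ∀ N, weightedSum H b L N - weightedSum H b' L' N =
        weightedSum (H ⊔ SimpleGraph.edge ℓ w) b L N := fun N =>
      (colorSum_weight_sup_edge _ hne hiso (fun _ _ => Iff.rfl) (Nat.pos_of_ne_zero hbℓ)
        (Nat.pos_of_ne_zero hbw)).symm
    have hm := sum_comp_update_update hne L (lexWeight B) (L w + L ℓ) 0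
    rw [lexWeight_zero, add_zero, ← hL'] at hm
    have hdeg := nbrCount_sup_edge hne hiso
    have hrest : ∏ u ∈ (univ.erase ℓ).erase w, leadFactor S (H ⊔ SimpleGraph.edge ℓ w) L u =
        ∏ u ∈ (univ.erase ℓ).erase w, leadFactor S H L u := by
      refine Finset.prod_congr rfl fun u hu => ?_
      simp only [mem_erase] at hu
      simp [leadFactor, hdeg, hu.1, hu.2.1]
    have hrest' : ∏ u ∈ (univ.erase ℓ).erase w, leadFactor S H L' u =
        ∏ u ∈ (univ.erase ℓ).erase w, leadFactor S H L u := by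
      refine Finset.prod_congr rfl fun u hu => ?_
      simp only [mem_erase] at hu
      simp [leadFactor, hL'u u hu.2.1 hu.1]
    have hdℓ : nbrCount H ℓ = 0 := nbrCount_eq_zero hiso
    rw [prod_split hne, hrest]
    rw [prod_split hne] at ih1
    rw [prod_split hne, hrest'] at ih2
    generalize ∏ u ∈ (univ.erase ℓ).erase w, leadFactor S H L u = P at ih1 ih2 ⊢
    by_cases hLℓ : L ℓ = 0
    -- With `L ℓ = 0` the contraction changes only `b`, which the leading term does not see: the two
    -- leading coefficients cancel. This matches the factor `1 - 1 = 0` of the new vertex `ℓ` of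
    -- degree one.
    · have e : L' = L := by
        rw [hL', hLℓ, add_zero, Function.update_eq_self, ← hLℓ, Function.update_eq_self]
      rw [e] at ih2
      refine (ih1.sub ih2).congr rfl (fun N => by rw [← hF N, e]) rfl ?_
      rw [sub_self]
      simp [leadFactor, hℓ, hLℓ, hdeg, hdℓ]
    -- If only `ℓ` carries leaves, they move to `w` and the leading exponent is unchanged. If both
    -- do, the contracted term starts strictly higher and contributes nothing.
    · by_cases hLw : L w = 0
      · rw [hLw, zero_add, lexWeight_zero] at hm
        rw [show ∑ u, lexWeight B (L' u) = ∑ u, lexWeight B (L u) by omega] at ih2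
        refine (ih1.sub ih2).congr rfl hF rfl ?_
        by_cases hwv : w = v
        · subst hwv
          simp [leadFactor, hℓ, hLℓ, hdeg, hdℓ, hL'ℓ, hL'w, hLw, hv]
          ring
        · have hwS : w ∉ S := fun h => hwv (hw h)
          simp only [hL'u v hvℓ (Ne.symm hwv)]
          simp [leadFactor, hℓ, hLℓ, hdeg, hdℓ, hL'ℓ, hL'w, hLw, hwS, hvℓ, Ne.symm hwv]
          split_ifs <;> ring
      · have hlt := lexWeight_add_lt hB (Nat.pos_of_ne_zero hLw) (Nat.pos_of_ne_zero hLℓ)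
        refine (ih1.sub (ih2.weaken
          (m' := ∑ u, lexWeight B (L u) + m₀) (by omega))).congr rfl hF rfl ?_
        rw [sub_zero]
        by_cases hwv : w = v
        · subst hwv
          simp [leadFactor, hLℓ, hLw]
        · simp [leadFactor, hLℓ, hLw, hdeg, hvℓ, Ne.symm hwv]

end LeafExtension

/-! ### Paths and cycles with leaves at one vertex only. -/

section PathCycle

variable {V : Type*} [Fintype V] [DecidableEq V] {B : ℕ}

/-- The path with vertices `a 0, …, a k`. -/
def pathOn (a : ℕ → V) : ℕ → SimpleGraph V
  | 0 => ⊥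
  | k + 1 => pathOn a k ⊔ SimpleGraph.edge (a (k + 1)) (a k)

/-- The cycle with vertices `a 0, …, a k`. -/
def cycleOn (a : ℕ → V) (k : ℕ) : SimpleGraph V :=
  pathOn a k ⊔ SimpleGraph.edge (a k) (a 0)

lemma exists_of_pathOn_adj {a : ℕ → V} {k : ℕ} {x y : V} (h : (pathOn a k).Adj x y) :
    ∃ i, i ≤ k ∧ x = a i := by
  induction k with
  | zero => exact h.elim
  | succ k ih =>
    rcases h with h | h
    · obtain ⟨i, hi, rfl⟩ := ih h
      exact ⟨i, by omega, rfl⟩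
    · rcases ((SimpleGraph.edge_adj ..).1 h).1 with ⟨rfl, -⟩ | ⟨rfl, -⟩
      exacts [⟨k + 1, le_rfl, rfl⟩, ⟨k, by omega, rfl⟩]

lemma pathOn_isolated {a : ℕ → V} {k : ℕ} (ha : Set.InjOn a (Set.Iic (k + 1))) (y : V) :
    ¬ (pathOn a k).Adj (a (k + 1)) y := by
  intro h
  obtain ⟨i, hi, e⟩ := exists_of_pathOn_adj h
  have := ha (Set.mem_Iic.2 le_rfl) (Set.mem_Iic.2 (by omega)) e
  omega

lemma leafExt_pathOn {a : ℕ → V} {k : ℕ} (ha : Set.InjOn a (Set.Iic k)) :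
    LeafExt ⊥ {a 0} (a 0) (pathOn a k) := by
  induction k with
  | zero => exact .core
  | succ k ih =>
    refine .attach (ih (ha.mono (Set.Iic_subset_Iic.2 (by omega)))) ?_ ?_ ?_ (pathOn_isolated ha)
    · intro h
      have := ha (Set.mem_Iic.2 le_rfl) (Set.mem_Iic.2 (by omega)) h
      omega
    · rw [Finset.mem_singleton]
      intro h
      have := ha (Set.mem_Iic.2 le_rfl) (Set.mem_Iic.2 (by omega)) h
      omega
    · exact fun h => Finset.mem_singleton.1 h

lemma nbrCount_pathOn {a : ℕ → V} {k : ℕ} (ha : Set.InjOn a (Set.Iic (k + 1))) {j : ℕ}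
    (hj : j ≤ k + 1) :
    nbrCount (pathOn a (k + 1)) (a j) = if j = 0 ∨ j = k + 1 then 1 else 2 := by
  have hinj : ∀ i j, i ≤ k + 1 → j ≤ k + 1 → (a i = a j ↔ i = j) := fun i j hi hj =>
    ⟨fun h => ha (Set.mem_Iic.2 hi) (Set.mem_Iic.2 hj) h, fun h => h ▸ rfl⟩
  have hne : a (k + 1) ≠ a k := by rw [Ne, hinj _ _ le_rfl (by omega)]; omega
  rw [pathOn, nbrCount_sup_edge hne (pathOn_isolated ha)]
  simp only [hinj _ _ hj le_rfl, hinj _ _ hj (Nat.le_succ k)]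
  rcases Nat.eq_or_lt_of_le hj with rfl | hj
  · rw [nbrCount_eq_zero (pathOn_isolated ha)]
    simp
  · cases k with
    | zero =>
      rw [pathOn, nbrCount_eq_zero (by simp)]
      have : j = 0 := by omega
      simp [this]
    | succ k =>
      rw [nbrCount_pathOn (ha.mono (Set.Iic_subset_Iic.2 (by omega))) (by omega)]
      split_ifs <;> omega

/-- The set of the vertices `a 0, …, a k`. -/
def vertsOn (a : ℕ → V) (k : ℕ) : Finset V := (range (k + 1)).image a

lemma mem_vertsOn {a : ℕ → V} {k j : ℕ} (h : j ≤ k) : a j ∈ vertsOn a k :=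
  mem_image_of_mem a (mem_range.2 (by omega))

/-- The last vertex is summed out as a leaf of `a (k + 1)`, whence the summand `lexWeight B 1`. The
rest is grown from the edgeless graph: the vertices `a 1, …, a k` have degree two and contribute
`-1` each, while `a 0` has degree one and contributes `1 - 1` if it carries no leaf. -/
lemma hasStarLead_pathOn (hB : 2 ≤ B) {a : ℕ → V} {k : ℕ} (ha : Set.InjOn a (Set.Iic (k + 2)))
    {b L : V → ℕ} (hbL : Admissible (vertsOn a (k + 2)) (a 0) b L) :
    HasStarLead B (∑ u, (b u + L u)) (weightedSum (pathOn a (k + 2)) b L)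
      (∑ u, lexWeight B (L u) + lexWeight B 1) (if L (a 0) = 0 then 0 else (-1) ^ k) := by
  have hinj : ∀ i j, i ≤ k + 2 → j ≤ k + 2 → (a i = a j ↔ i = j) := fun i j hi hj =>
    ⟨fun h => ha (Set.mem_Iic.2 hi) (Set.mem_Iic.2 hj) h, fun h => h ▸ rfl⟩
  have hor : ∀ j, 0 < j → j ≤ k + 2 → b (a j) = 1 ∧ L (a j) = 0 := fun j h0 hj =>
    hbL.original _ (mem_vertsOn hj) (by rw [Ne, hinj _ _ hj (by omega)]; omega)
  have hne : a (k + 2) ≠ a (k + 1) := by rw [Ne, hinj _ _ le_rfl (by omega)]; omega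
  have hne0 : a 0 ≠ a (k + 1) := by rw [Ne, hinj _ _ (by omega) (by omega)]; omega
  have hne0' : a 0 ≠ a (k + 2) := by rw [Ne, hinj _ _ (by omega) (by omega)]; omega
  obtain ⟨hb2, hL2⟩ := hor (k + 2) (by omega) le_rfl
  obtain ⟨hb1, hL1⟩ := hor (k + 1) (by omega) (by omega)
  have hsub : Set.InjOn a (Set.Iic (k + 1)) := ha.mono (Set.Iic_subset_Iic.2 (by omega))
  set b' := Function.update b (a (k + 2)) 0 with hb'
  set L' := Function.update L (a (k + 1)) (L (a (k + 1)) + 1) with hL'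
  have hadm : Admissible {a 0} (a 0) b' L' := by
    refine ⟨?_, ?_, ?_⟩
    · simp only [Finset.mem_singleton, forall_eq]
      rw [hb', Function.update_of_ne hne0']
      exact hbL.ne_zero _ (mem_vertsOn (by omega))
    · simp only [Finset.mem_singleton, forall_eq]
      exact fun h => (h rfl).elim
    · intro u hu
      by_cases h2 : u = a (k + 2)
      · rw [hL', h2, Function.update_of_ne hne, hL2]
      · rw [hb', Function.update_of_ne h2] at hu
        have h1 : u ≠ a (k + 1) := by rintro rfl; omega
        rw [hL', Function.update_of_ne h1]
        exact hbL.removed u hu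
  -- The core is the single vertex `a 0` in the edgeless graph, whose coefficient is 1 whatever `L`
  -- is.
  have h := (leafExt_pathOn hsub).hasStarLead (K := ⊥) (m₀ := 0) (A := 1) (E := 1) hB
    (Finset.mem_singleton_self _) (fun u _ x (h : False) => h)
    (fun b L h => (hasStarLead_weightedSum_bot hB h.removed).congr rfl (fun _ => rfl)
      (add_zero _).symm (by simp)) hadm ?_
  · rw [sum_leaf hne hb2] at h
    have hm := sum_comp_update_update hne L (lexWeight B) (L (a (k + 1)) + 1) (L (a (k + 2)))
    have e : Function.update (Function.update L (a (k + 1)) (L (a (k + 1)) + 1)) (a (k + 2))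
        (L (a (k + 2))) = L' := by
      rw [Function.update_eq_self_iff, Function.update_of_ne hne]
    rw [e, hL1, hL2, lexWeight_zero] at hm
    refine h.congr rfl (fun N => ?_) (by omega) ?_
    · exact (colorSum_weight_sup_edge_leaf _ hne (pathOn_isolated ha) hb2 hL2 (by omega)).symm
    · have hL0 : L' (a 0) = L (a 0) := by rw [hL', Function.update_of_ne hne0]
      rw [hL0, nbrCount_pathOn hsub (by omega), nbrCount_eq_zero (by simp)]
      split_ifs with h0 h1
      · simp
      · exact (h1 (Or.inl rfl)).elim
      · rw [one_mul, ← Finset.prod_subset (Finset.subset_univ ((Ico 1 (k + 1)).image a)),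
          Finset.prod_image]
        · rw [Finset.prod_congr rfl (g := fun _ => (-1 : ℚ))]
          · simp
          · intro j hj
            rw [mem_Ico] at hj
            have e1 : L' (a j) = 0 := by
              rw [hL', Function.update_of_ne, (hor j (by omega) (by omega)).2]
              rw [Ne, hinj _ _ (by omega) (by omega)]
              omega
            have e2 : a j ∉ ({a 0} : Finset V) := by
              rw [Finset.mem_singleton, hinj _ _ (by omega) (by omega)]
              omega
            rw [leadFactor, if_pos ⟨e2, e1⟩, nbrCount_pathOn hsub (by omega), if_neg (by omega)]
            norm_num
        · intro i hi j hj hij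
          rw [Finset.mem_coe, mem_Ico] at hi hj
          exact (hinj i j (by omega) (by omega)).1 hij
        · intro u _ hu
          rw [leadFactor]
          split_ifs with hu'
          · rw [nbrCount_eq_zero, Nat.cast_zero, sub_zero]
            intro x hx
            obtain ⟨i, hi, rfl⟩ := exists_of_pathOn_adj hx
            rcases Nat.eq_zero_or_pos i with rfl | hi0
            · simp at hu'
            · by_cases hik : i = k + 1
              · subst hik
                rw [hL', Function.update_self] at hu'
                omega
              · exact hu (mem_image_of_mem a (mem_Ico.2 (by omega)))
          · rfl
  · intro u x hx
    obtain ⟨i, hi, rfl⟩ := exists_of_pathOn_adj hx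
    rw [hb', Function.update_of_ne]
    · exact hbL.ne_zero _ (mem_vertsOn (by omega))
    · rw [Ne, hinj _ _ (by omega) (by omega)]
      omega

/-- Deleting the closing edge leaves a path, contracting it leaves a cycle with one vertex fewer, so
each step takes the path coefficient minus the previous cycle coefficient. The contraction raises `b
(a 0)` but leaves `L` alone. -/
lemma hasStarLead_cycleOn (hB : 2 ≤ B) {a : ℕ → V} {k : ℕ} (ha : Set.InjOn a (Set.Iic (k + 1)))
    {b L : V → ℕ} (hbL : Admissible (vertsOn a (k + 1)) (a 0) b L) :
    HasStarLead B (∑ u, (b u + L u)) (weightedSum (cycleOn a (k + 1)) b L)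
      (∑ u, lexWeight B (L u) + lexWeight B 1)
      (if L (a 0) = 0 then (-1) ^ k else (-1) ^ (k + 1) * k) := by
  induction k generalizing b L with
  -- The recursion ends at the degenerate cycle on two vertices, a single edge: `a 1` becomes a leaf
  -- of `a 0`. This gives exactly `lexWeight B 1` if `L (a 0) = 0`, and something strictly higher,
  -- hence coefficient zero, otherwise.
  | zero =>
    have hne : a 1 ≠ a 0 := fun h => by
      have := ha (Set.mem_Iic.2 (by omega)) (Set.mem_Iic.2 (by omega)) h
      omega
    obtain ⟨hb1, hL1⟩ := hbL.original (a 1) (mem_vertsOn (by omega)) hne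
    have hb0 := hbL.ne_zero (a 0) (mem_vertsOn (by omega))
    have hF : ∀ N, weightedSum ⊥ (Function.update b (a 1) 0)
        (Function.update L (a 0) (L (a 0) + 1)) N = weightedSum (cycleOn a (0 + 1)) b L N := by
      intro N
      rw [weightedSum, ← colorSum_weight_sup_edge_leaf _ hne (by simp) hb1 hL1 (by omega)]
      simp [weightedSum, cycleOn, pathOn]
    have h := hasStarLead_weightedSum_bot hB (b := Function.update b (a 1) 0)
      (L := Function.update L (a 0) (L (a 0) + 1)) ?_
    · rw [sum_leaf hne hb1] at h
      have hm := sum_comp_update_update hne L (lexWeight B) (L (a 0) + 1) (L (a 1))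
      have e : Function.update (Function.update L (a 0) (L (a 0) + 1)) (a 1) (L (a 1)) =
          Function.update L (a 0) (L (a 0) + 1) := by
        rw [Function.update_eq_self_iff, Function.update_of_ne hne]
      rw [e, hL1, lexWeight_zero] at hm
      by_cases h0 : L (a 0) = 0
      · refine h.congr rfl hF ?_ (by simp [h0])
        rw [h0, lexWeight_zero, zero_add] at hm
        rw [h0]
        omega
      · have := lexWeight_add_lt hB (Nat.pos_of_ne_zero h0) one_pos
        exact (h.weaken (m' := ∑ u, lexWeight B (L u) + lexWeight B 1) (by omega)).congr rfl hF
          rfl (by simp [h0])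
    · intro u hu
      by_cases h1 : u = a 1
      · rw [h1, Function.update_of_ne hne, hL1]
      · rw [Function.update_of_ne h1] at hu
        have h2 : u ≠ a 0 := by rintro rfl; omega
        rw [Function.update_of_ne h2]
        exact hbL.removed u hu
  | succ k ih =>
    have hinj : ∀ i j, i ≤ k + 2 → j ≤ k + 2 → (a i = a j ↔ i = j) := fun i j hi hj =>
      ⟨fun h => ha (Set.mem_Iic.2 hi) (Set.mem_Iic.2 hj) h, fun h => h ▸ rfl⟩
    have hne : a (k + 2) ≠ a 0 := by rw [Ne, hinj _ _ le_rfl (by omega)]; omega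
    have hne1 : a (k + 2) ≠ a (k + 1) := by rw [Ne, hinj _ _ le_rfl (by omega)]; omega
    have hne2 : a (k + 1) ≠ a 0 := by rw [Ne, hinj _ _ (by omega) (by omega)]; omega
    obtain ⟨hb2, hL2⟩ := hbL.original (a (k + 2)) (mem_vertsOn le_rfl) hne
    have hb0 := hbL.ne_zero (a 0) (mem_vertsOn (by omega))
    set b' := Function.update (Function.update b (a 0) (b (a 0) + b (a (k + 2)))) (a (k + 2)) 0
      with hb'
    have hL' : Function.update (Function.update L (a 0) (L (a 0) + L (a (k + 2)))) (a (k + 2)) 0 =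
        L := by
      rw [hL2, add_zero, Function.update_eq_self, ← hL2, Function.update_eq_self]
    have hadm : Admissible (vertsOn a (k + 1)) (a 0) b' L := by
      have hmem : ∀ u ∈ vertsOn a (k + 1), u ≠ a (k + 2) ∧ u ∈ vertsOn a (k + 2) := by
        intro u hu
        obtain ⟨i, hi, rfl⟩ := mem_image.1 hu
        rw [mem_range] at hi
        refine ⟨?_, mem_vertsOn (by omega)⟩
        rw [Ne, hinj _ _ (by omega) le_rfl]
        omega
      refine ⟨fun u hu => ?_, fun u hu huv => ?_, fun u hu => ?_⟩
      · rw [hb', Function.update_of_ne (hmem u hu).1]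
        by_cases h0 : u = a 0
        · rw [h0, Function.update_self]; omega
        · rw [Function.update_of_ne h0]
          exact hbL.ne_zero u (hmem u hu).2
      · rw [hb', Function.update_of_ne (hmem u hu).1, Function.update_of_ne huv]
        exact hbL.original u (hmem u hu).2 huv
      · by_cases h2 : u = a (k + 2)
        · rw [h2, hL2]
        · rw [hb', Function.update_of_ne h2] at hu
          by_cases h0 : u = a 0
          · rw [h0, Function.update_self] at hu; omega
          · rw [Function.update_of_ne h0] at hu
            exact hbL.removed u hu
    have h1 := hasStarLead_pathOn hB ha hbL
    have h2 := ih (ha.mono (Set.Iic_subset_Iic.2 (by omega))) hadm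
    have hsum := sum_merge hne b L
    rw [hL'] at hsum
    rw [hsum] at h2
    refine (h1.sub h2).congr rfl (fun N => ?_) rfl ?_
    · have hDC := colorSum_weight_sup_edge (R := MvPolynomial (Fin (N + 1)) ℚ) MvPolynomial.X
        (H := pathOn a (k + 2)) (H' := cycleOn a (k + 1)) hne ?_ ?_ (b := b) (L := L)
        (by omega) (by omega)
      · rw [hL'] at hDC
        exact hDC.symm
      · intro y hy
        rcases hy with h | h
        · exact pathOn_isolated ha _ h
        · rcases ((SimpleGraph.edge_adj ..).1 h).1 with ⟨h, -⟩ | ⟨h, -⟩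
          exacts [hne1 h, hne h]
      -- When `a (k + 2)` and `a 0` share a colour, the last path edge imposes the same condition as
      -- the closing edge from `a (k + 1)` to `a 0`.
      · intro κ hκ
        rw [pathOn, cycleOn, proper_sup_edge hne1, proper_sup_edge hne2, hκ, ne_comm (b := κ (a 0))]
    · push_cast
      split_ifs <;> ring

end PathCycle

/-! ### Summing out all leaves of a graph. -/

section Stripping

variable {V : Type*} [Fintype V] [DecidableEq V]

/-- The graph `G` with all edges at vertices of `A` removed. -/
def isolate (G : SimpleGraph V) (A : Finset V) : SimpleGraph V where
  Adj x y := G.Adj x y ∧ x ∉ A ∧ y ∉ A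
  symm := ⟨fun _ _ h => ⟨h.1.symm, h.2.2, h.2.1⟩⟩
  loopless := ⟨fun _ h => h.1.ne rfl⟩

lemma isolate_insert {G : SimpleGraph V} {A : Finset V} {ℓ w : V} (hℓ : ℓ ∉ A)
    (hw : ∀ x, G.Adj ℓ x ↔ x = w) (hwA : w ∉ A) :
    isolate G A = isolate G (insert ℓ A) ⊔ SimpleGraph.edge ℓ w := by
  have hne : ℓ ≠ w := ((hw w).2 rfl).ne
  ext x y
  simp only [isolate, SimpleGraph.sup_adj, SimpleGraph.edge_adj, mem_insert, not_or]
  constructor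
  · rintro ⟨h, hx, hy⟩
    by_cases h1 : x = ℓ
    · subst h1
      exact Or.inr ⟨Or.inl ⟨rfl, (hw y).1 h⟩, h.ne⟩
    by_cases h2 : y = ℓ
    · subst h2
      exact Or.inr ⟨Or.inr ⟨(hw x).1 h.symm, rfl⟩, h.ne⟩
    · exact Or.inl ⟨h, ⟨h1, hx⟩, h2, hy⟩
  · rintro (⟨h, ⟨-, hx⟩, -, hy⟩ | ⟨⟨rfl, rfl⟩ | ⟨rfl, rfl⟩, -⟩)
    · exact ⟨h, hx, hy⟩
    · exact ⟨(hw y).2 rfl, hℓ, hwA⟩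
    · exact ⟨((hw x).2 rfl).symm, hwA, hℓ⟩

/-- The colours of a set of leaves can be summed out. -/
lemma weightedSum_isolate (G : SimpleGraph V) (N : ℕ) (A : Finset V)
    (hA : ∀ ℓ ∈ A, ∃ w, (∀ x, G.Adj ℓ x ↔ x = w) ∧ w ∉ A) :
    weightedSum G (fun _ => 1) (fun _ => 0) N =
      weightedSum (isolate G A) (fun u => if u ∈ A then 0 else 1)
        (fun u => (G.neighborSet u ∩ A).ncard) N ∧
      ∑ u, ((if u ∈ A then 0 else 1) + (G.neighborSet u ∩ A).ncard) = Fintype.card V := by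
  induction A using Finset.induction_on with
  | empty =>
    have : isolate G ∅ = G := by ext; simp [isolate]
    simp [this]
  | insert ℓ A hℓ ih =>
    obtain ⟨w, hw, hwA⟩ := hA ℓ (mem_insert_self _ _)
    have hwA' : w ∉ A := fun h => hwA (mem_insert_of_mem h)
    have hne : ℓ ≠ w := ((hw w).2 rfl).ne
    obtain ⟨ih1, ih2⟩ := ih fun x hx => by
      obtain ⟨w, hw, hwA⟩ := hA x (mem_insert_of_mem hx)
      exact ⟨w, hw, fun h => hwA (mem_insert_of_mem h)⟩
    have hL : (G.neighborSet ℓ ∩ A).ncard = 0 := by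
      rw [Set.ncard_eq_zero]
      ext x
      simp only [Set.mem_inter_iff, SimpleGraph.mem_neighborSet, hw, Finset.mem_coe,
        Set.mem_empty_iff_false, iff_false, not_and]
      rintro rfl
      exact hwA'
    have hiso : ∀ x, ¬ (isolate G (insert ℓ A)).Adj ℓ x := fun x h =>
      h.2.1 (mem_insert_self _ _)
    have hbu : Function.update (fun u => if u ∈ A then 0 else 1) ℓ 0 =
        fun u => if u ∈ insert ℓ A then 0 else 1 := by
      funext u
      by_cases h : u = ℓ
      · simp [h]
      · simp [h]
    have hLu : Function.update (fun u => (G.neighborSet u ∩ A).ncard) w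
        ((G.neighborSet w ∩ A).ncard + 1) =
        fun u => (G.neighborSet u ∩ (insert ℓ A : Finset V)).ncard := by
      funext u
      by_cases h : u = w
      · subst h
        have hins : G.neighborSet u ∩ (insert ℓ A : Finset V) = insert ℓ (G.neighborSet u ∩ A) := by
          rw [Finset.coe_insert, Set.inter_insert_of_mem]
          exact ((hw u).2 rfl).symm
        rw [Function.update_self, hins, Set.ncard_insert_of_notMem fun h => hℓ h.2]
      · have hins : G.neighborSet u ∩ (insert ℓ A : Finset V) = G.neighborSet u ∩ A := by
          rw [Finset.coe_insert, Set.inter_insert_of_notMem]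
          exact fun h' => h ((hw u).1 (SimpleGraph.Adj.symm h'))
        rw [Function.update_of_ne h, hins]
    constructor
    · rw [ih1, isolate_insert hℓ hw hwA', weightedSum, colorSum_weight_sup_edge_leaf
        (b := fun u => if u ∈ A then 0 else 1) (L := fun u => (G.neighborSet u ∩ A).ncard)
        _ hne hiso (by simp [hℓ]) hL (by simp [hwA']), weightedSum, hbu, hLu]
    · have h := sum_leaf hne (b := fun u => if u ∈ A then 0 else 1)
        (L := fun u => (G.neighborSet u ∩ A).ncard) (by simp [hℓ])
      rw [hbu, hLu] at h
      rw [h, ih2]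

end Stripping

/-! ### Distances and bridges in a unicyclic graph. -/

section Rank

variable {V : Type*} [Fintype V] [DecidableEq V]

/-- A graph all of whose edges outside of `K` lead from a vertex outside of `S` to its only
neighbour of smaller or equal rank is built from `K` by attaching leaves. -/
lemma leafExt_of_rank {K : SimpleGraph V} {S : Finset V} {v : V} (d : V → ℕ)
    (hKS : ∀ x y, K.Adj x y → x ∈ S) (H : SimpleGraph V) (hKH : K ≤ H)
    (h1 : ∀ x y, H.Adj x y → ¬ K.Adj x y → d x ≠ d y)
    (h2 : ∀ u x y, u ∉ S → H.Adj u x → H.Adj u y → d x ≤ d u → d y ≤ d u → x = y)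
    (h3 : ∀ x y, H.Adj x y → ¬ K.Adj x y → d x < d y → y ∉ S ∧ (x ∈ S → x = v)) :
    LeafExt K S v H := by
  classical
  induction hn : H.edgeSet.ncard using Nat.strong_induction_on generalizing H with
  | _ n ih =>
    -- The upper ends of the edges outside `K`. One of maximal rank has no neighbour of larger rank,
    -- hence only one neighbour: it was attached last.
    let U : Finset V := univ.filter fun y => ∃ x, H.Adj x y ∧ ¬ K.Adj x y ∧ d x < d y
    rcases U.eq_empty_or_nonempty with hU | hU
    · have : H = K := by
        refine le_antisymm (fun x y hxy => ?_) hKH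
        by_contra hK
        rcases (h1 x y hxy hK).lt_or_gt with h | h
        · exact (Finset.eq_empty_iff_forall_notMem.1 hU y) (mem_filter.2 ⟨mem_univ _, x, hxy, hK, h⟩)
        · exact (Finset.eq_empty_iff_forall_notMem.1 hU x)
            (mem_filter.2 ⟨mem_univ _, y, hxy.symm, fun h' => hK h'.symm, h⟩)
      rw [this]
      exact .core
    · obtain ⟨u, huU, humax⟩ := U.exists_max_image d hU
      obtain ⟨x, hxu, hK, hd⟩ := (mem_filter.1 huU).2
      obtain ⟨huS, hx⟩ := h3 x u hxu hK hd
      have huniq : ∀ y, H.Adj u y → y = x := by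
        intro y hy
        refine h2 u y x huS hy hxu.symm ?_ hd.le
        by_contra hlt
        rw [not_le] at hlt
        have := humax y (mem_filter.2 ⟨mem_univ _, u, hy, fun h => huS (hKS _ _ h), hlt⟩)
        omega
      have hle : H.deleteEdges {s(u, x)} ≤ H := SimpleGraph.deleteEdges_le _
      have hH : H = H.deleteEdges {s(u, x)} ⊔ SimpleGraph.edge u x := by
        ext y z
        simp only [SimpleGraph.sup_adj, SimpleGraph.deleteEdges_adj, SimpleGraph.adj_edge,
          Set.mem_singleton_iff]
        constructor
        · intro h
          by_cases he : s(y, z) = s(u, x)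
          · exact Or.inr ⟨he.symm, h.ne⟩
          · exact Or.inl ⟨h, he⟩
        · rintro (h | ⟨h, -⟩)
          · exact h.1
          · have : s(u, x) ∈ H.edgeSet := hxu.symm
            rwa [h] at this
      rw [hH]
      refine .attach ?_ hxu.ne.symm huS hx ?_
      · refine ih _ ?_ (H.deleteEdges {s(u, x)}) ?_ (fun y z h => h1 y z (hle h))
          (fun u x y hu hx hy => h2 u x y hu (hle hx) (hle hy)) (fun y z h => h3 y z (hle h)) rfl
        · rw [← hn]
          refine Set.ncard_lt_ncard ?_ (Set.toFinite _)
          rw [SimpleGraph.edgeSet_deleteEdges]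
          refine ⟨Set.sdiff_subset, fun h => ?_⟩
          exact (h (show s(u, x) ∈ H.edgeSet from hxu.symm)).2 rfl
        · intro y z hyz
          refine (SimpleGraph.deleteEdges_adj).2 ⟨hKH hyz, fun h => ?_⟩
          rw [Set.mem_singleton_iff, Sym2.eq_iff] at h
          rcases h with ⟨rfl, rfl⟩ | ⟨rfl, rfl⟩
          exacts [huS (hKS _ _ hyz), hK hyz]
      · intro y hy
        rw [SimpleGraph.deleteEdges_adj] at hy
        exact hy.2 (by rw [huniq y hy.1]; rfl)

/-- A shortest path from `v` to a vertex other than `u` and no farther away than `u` cannot pass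
through `u`. -/
lemma reachable_isolate {G : SimpleGraph V} (hG : G.Connected) (v u : V) (n : ℕ) (x : V)
    (hn : G.dist v x = n) (hu : n ≤ G.dist v u) (hx : x ≠ u) :
    (isolate G {u}).Reachable v x := by
  induction n generalizing x with
  | zero =>
    rw [hG.dist_eq_zero_iff] at hn
    rw [hn]
  | succ n ih =>
    obtain ⟨p, hp⟩ := hG.exists_walk_length_eq_dist x v
    rw [SimpleGraph.dist_comm, hn] at hp
    cases p with
    | nil => simp at hp
    | @cons _ y _ h p =>
      rw [SimpleGraph.Walk.length_cons] at hp
      have h1 : G.dist v y ≤ n := by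
        rw [SimpleGraph.dist_comm]
        exact (SimpleGraph.dist_le p).trans (by omega)
      have h2 : G.dist v x ≤ G.dist v y + 1 := by
        have := hG.dist_triangle (u := v) (v := y) (w := x)
        rwa [SimpleGraph.dist_eq_one_iff_adj.2 h.symm] at this
      have hyu : y ≠ u := by rintro rfl; omega
      refine (ih y (by omega) (by omega) hyu).trans (SimpleGraph.Adj.reachable ?_)
      exact ⟨h.symm, by simpa using hyu, by simpa using hx⟩

lemma isolate_le_deleteEdges (G : SimpleGraph V) (u x : V) :
    isolate G {u} ≤ G.deleteEdges {s(u, x)} := by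
  intro y z h
  rw [SimpleGraph.deleteEdges_adj]
  refine ⟨h.1, fun he => ?_⟩
  rw [Set.mem_singleton_iff, Sym2.eq_iff] at he
  have h1 := h.2.1
  have h2 := h.2.2
  rw [Finset.mem_singleton] at h1 h2
  rcases he with ⟨h, -⟩ | ⟨-, h⟩
  exacts [h1 h, h2 h]

/-- An edge lying on some cycle would lie on `C`, the only cycle. -/
lemma IsConnectedUnicyclic.isBridge {G : SimpleGraph V} {C : G.Subgraph}
    (hG : IsConnectedUnicyclic G C) {x y : V} (h : G.Adj x y) (hC : ¬ C.Adj x y) :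
    G.IsBridge s(x, y) := by
  refine (SimpleGraph.isBridge_iff_forall_cycle_notMem h).2 fun u p hp he => hC ?_
  rw [← hG.unique _ ⟨u, p, hp, rfl⟩]
  exact SimpleGraph.Walk.adj_toSubgraph_iff_mem_edges.2 he

/-- At equal distance, shortest paths from `v` to `x` and to `y` would join the ends of the bridge
`xy` without using it. -/
lemma IsConnectedUnicyclic.dist_ne {G : SimpleGraph V} {C : G.Subgraph}
    (hG : IsConnectedUnicyclic G C) (v : V) {x y : V} (h : G.Adj x y) (hC : ¬ C.Adj x y) :
    G.dist v x ≠ G.dist v y := by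
  intro hd
  refine SimpleGraph.isBridge_iff.1 (hG.isBridge h hC) ?_
  have h1 := reachable_isolate hG.connected v x _ y rfl hd.ge h.ne.symm
  have h2 := reachable_isolate hG.connected v y _ x rfl hd.le h.ne
  refine (h2.symm.mono ?_).trans (h1.mono (isolate_le_deleteEdges G x y))
  rw [Sym2.eq_swap]
  exact isolate_le_deleteEdges G y x

/-- Otherwise the detour from `u` to `y`, then to `x` through `v` while avoiding `u`, would bypass
the bridge `ux`. -/
lemma IsConnectedUnicyclic.parent_unique {G : SimpleGraph V} {C : G.Subgraph}
    (hG : IsConnectedUnicyclic G C) (v : V) {u x y : V} (hx : G.Adj u x) (hy : G.Adj u y)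
    (hC : ¬ C.Adj u x) (hdx : G.dist v x ≤ G.dist v u) (hdy : G.dist v y ≤ G.dist v u) :
    x = y := by
  by_contra hxy
  refine SimpleGraph.isBridge_iff.1 (hG.isBridge hx hC) ?_
  have h1 := reachable_isolate hG.connected v u _ x rfl hdx hx.ne.symm
  have h2 := reachable_isolate hG.connected v u _ y rfl hdy hy.ne.symm
  have h3 : (G.deleteEdges {s(u, x)}).Adj u y := by
    rw [SimpleGraph.deleteEdges_adj]
    refine ⟨hy, fun h => ?_⟩
    rw [Set.mem_singleton_iff, Sym2.eq_iff] at h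
    rcases h with ⟨-, h⟩ | ⟨h, -⟩
    exacts [hxy h.symm, hx.ne h]
  exact h3.reachable.trans ((h2.symm.trans h1).mono (isolate_le_deleteEdges G u x))

/-- If only the rooted tree at `v` is non-trivial then all other vertices of the cycle have all
their edges on the cycle. -/
lemma adj_of_nontrivialRoots {G : SimpleGraph V} {C : G.Subgraph} {v : V}
    (hv : nontrivialRoots G C = {v}) {x y : V} (hx : x ∈ C.verts) (hxv : x ≠ v)
    (h : G.Adj x y) : C.Adj x y := by
  by_contra hC
  have hmem : x ∈ nontrivialRoots G C := by
    refine ⟨hx, x, SimpleGraph.Reachable.refl _, y, SimpleGraph.Adj.reachable ?_, h.ne⟩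
    rw [SimpleGraph.deleteEdges_adj]
    exact ⟨h, hC⟩
  rw [hv] at hmem
  exact hxv hmem

lemma exists_adj_of_nontrivialRoots {G : SimpleGraph V} {C : G.Subgraph} {v : V}
    (hv : nontrivialRoots G C = {v}) : v ∈ C.verts ∧ ∃ x, G.Adj v x ∧ ¬ C.Adj v x := by
  have hmem : v ∈ nontrivialRoots G C := hv ▸ Set.mem_singleton v
  refine ⟨hmem.1, ?_⟩
  obtain ⟨y, hy, hyv⟩ := hmem.2.exists_ne v
  obtain ⟨p⟩ := (hy : (G.deleteEdges C.edgeSet).Reachable v y)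
  cases p with
  | nil => exact (hyv rfl).elim
  | cons h p =>
    rw [SimpleGraph.deleteEdges_adj] at h
    exact ⟨_, h.1, h.2⟩

end Rank

/-! ### The cycle of the graph as an explicit sequence of vertices. -/

section CycleWalk

variable {V : Type*} [Fintype V] [DecidableEq V]

lemma pathOn_adj_iff {a : ℕ → V} {k : ℕ} (hne : ∀ i < k, a i ≠ a (i + 1)) {x y : V} :
    (pathOn a k).Adj x y ↔ ∃ i < k, s(a i, a (i + 1)) = s(x, y) := by
  induction k with
  | zero => simp [pathOn]
  | succ k ih =>
    rw [pathOn, SimpleGraph.sup_adj, ih fun i hi => hne i (by omega), SimpleGraph.adj_edge,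
      Sym2.eq_swap (a := a (k + 1))]
    constructor
    · rintro (⟨i, hi, h⟩ | ⟨h, -⟩)
      exacts [⟨i, by omega, h⟩, ⟨k, by omega, h⟩]
    · rintro ⟨i, hi, h⟩
      rcases Nat.lt_succ_iff_lt_or_eq.1 hi with hi | rfl
      · exact Or.inl ⟨i, hi, h⟩
      · refine Or.inr ⟨h, ?_⟩
        rintro rfl
        rw [Sym2.eq_iff] at h
        rcases h with ⟨h1, h2⟩ | ⟨h1, h2⟩ <;> exact hne i hi (h1.trans h2.symm)

lemma cycleOn_getVert {G : SimpleGraph V} {v : V} {q : G.Walk v v} {k : ℕ}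
    (hk : q.length = k + 1) :
    cycleOn q.getVert k = q.toSubgraph.spanningCoe := by
  have hv : q.getVert 0 = q.getVert (k + 1) := by
    rw [← hk, SimpleGraph.Walk.getVert_length, SimpleGraph.Walk.getVert_zero]
  have hne : ∀ i < k + 1, q.getVert i ≠ q.getVert (i + 1) := fun i hi =>
    (q.adj_getVert_succ (by omega)).ne
  ext x y
  rw [SimpleGraph.Subgraph.spanningCoe_adj, SimpleGraph.Walk.toSubgraph_adj_iff, cycleOn,
    SimpleGraph.sup_adj, pathOn_adj_iff fun i hi => hne i (by omega), SimpleGraph.adj_edge, hv]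
  constructor
  · rintro (⟨i, hi, h⟩ | ⟨h, -⟩)
    exacts [⟨i, h, by omega⟩, ⟨k, h, by omega⟩]
  · rintro ⟨i, h, hi⟩
    by_cases hik : i = k
    · subst hik
      refine Or.inr ⟨h, ?_⟩
      rintro rfl
      rw [Sym2.eq_iff] at h
      rcases h with ⟨h1, h2⟩ | ⟨h1, h2⟩ <;> exact hne i (by omega) (h1.trans h2.symm)
    · exact Or.inl ⟨i, by omega, h⟩

lemma vertsOn_getVert {G : SimpleGraph V} {v : V} {q : G.Walk v v} {k : ℕ}
    (hk : q.length = k + 1) : (vertsOn q.getVert k : Set V) = q.toSubgraph.verts := by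
  ext x
  rw [SimpleGraph.Walk.mem_verts_toSubgraph, SimpleGraph.Walk.mem_support_iff_exists_getVert,
    Finset.mem_coe, vertsOn, mem_image]
  constructor
  · rintro ⟨i, hi, rfl⟩
    rw [mem_range] at hi
    exact ⟨i, rfl, by omega⟩
  · rintro ⟨i, rfl, hi⟩
    by_cases hik : i = k + 1
    · refine ⟨0, mem_range.2 (by omega), ?_⟩
      rw [hik, ← hk, SimpleGraph.Walk.getVert_length, SimpleGraph.Walk.getVert_zero]
    · exact ⟨i, mem_range.2 (by omega), rfl⟩

/-- The cycle can be written as `a 0, …, a (k + 2)` with a given first and last vertex. -/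
lemma exists_cycleOn {G : SimpleGraph V} {C : G.Subgraph} (hC : IsCycleSubgraph G C) {v w : V}
    (hvw : C.Adj v w) : ∃ (k : ℕ) (a : ℕ → V), Set.InjOn a (Set.Iic (k + 2)) ∧ a 0 = v ∧
      a (k + 2) = w ∧ C.spanningCoe = cycleOn a (k + 2) ∧ C.verts = vertsOn a (k + 2) := by
  obtain ⟨u, q, hq, rfl⟩ := hC
  have hv : v ∈ q.support := SimpleGraph.Walk.mem_support_of_adj_toSubgraph hvw
  obtain ⟨q', hq', hsub⟩ : ∃ q' : G.Walk v v, q'.IsCycle ∧ q'.toSubgraph = q.toSubgraph :=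
    ⟨q.rotate v hv, hq.rotate hv, q.toSubgraph_rotate hv⟩
  rw [← hsub] at hvw ⊢
  have main : ∀ r : G.Walk v v, r.IsCycle → r.getVert (r.length - 1) = w →
      ∃ (k : ℕ) (a : ℕ → V), Set.InjOn a (Set.Iic (k + 2)) ∧ a 0 = v ∧
      a (k + 2) = w ∧ r.toSubgraph.spanningCoe = cycleOn a (k + 2) ∧
      r.toSubgraph.verts = vertsOn a (k + 2) := by
    intro r hr hw
    obtain ⟨k, hk⟩ := Nat.exists_eq_add_of_le hr.three_le_length
    refine ⟨k, r.getVert, ?_, r.getVert_zero, ?_, ?_, ?_⟩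
    · have := hr.getVert_injOn'
      rwa [hk, show 3 + k - 1 = k + 2 by omega] at this
    · rw [← hw, hk, show 3 + k - 1 = k + 2 by omega]
    · exact (cycleOn_getVert (by omega)).symm
    · exact (vertsOn_getVert (by omega)).symm
  obtain ⟨i, h, hi⟩ := (SimpleGraph.Walk.toSubgraph_adj_iff _).1 hvw
  rw [Sym2.eq_iff] at h
  rcases h with ⟨h1, h2⟩ | ⟨h1, h2⟩
  -- Here the walk leaves `v` towards `w`; reversed, it returns to `v` from `w`, as required.
  · rw [← SimpleGraph.Walk.toSubgraph_reverse]
    refine main q'.reverse hq'.reverse ?_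
    have h0 : i = 0 := by
      rcases (hq'.getVert_endpoint_iff hi.le).1 h1 with h | h
      exacts [h, by omega]
    subst h0
    rw [SimpleGraph.Walk.getVert_reverse, SimpleGraph.Walk.length_reverse, ← h2]
    congr 1
    omega
  · refine main q' hq' ?_
    have h0 : i + 1 = q'.length := by
      rcases (hq'.getVert_endpoint_iff (by omega)).1 h2 with h | h
      exacts [by omega, h]
    rw [← h1, ← h0, Nat.add_sub_cancel]

end CycleWalk

/-! ### Algebraic independence of the stars. -/

section Independence

open MvPolynomial

/-- A surjective endomorphism of a Noetherian ring is injective. -/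
lemma injective_of_surjective_ringHom {R : Type*} [CommRing R] [IsNoetherianRing R] (f : R →+* R)
    (hf : Function.Surjective f) : Function.Injective f := by
  have hmono : Monotone fun n : ℕ => RingHom.ker (f ^ n) := by
    refine monotone_nat_of_le_succ fun n x hx => ?_
    rw [RingHom.mem_ker] at hx ⊢
    rw [pow_succ', RingHom.mul_def, RingHom.comp_apply, hx, map_zero]
  obtain ⟨n, hn⟩ := monotone_stabilizes_iff_noetherian.2 ‹IsNoetherianRing R› ⟨_, hmono⟩
  have hsurj : Function.Surjective (f ^ n) := by
    rw [RingHom.coe_pow]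
    exact hf.iterate n
  rw [injective_iff_map_eq_zero]
  intro x hx
  obtain ⟨y, rfl⟩ := hsurj x
  -- The kernels of the iterates stabilise at `n`, so an element `f ^ n y` killed by `f` is already
  -- zero.
  have h1 : y ∈ RingHom.ker (f ^ (n + 1)) := by
    rw [RingHom.mem_ker, pow_succ', RingHom.mul_def, RingHom.comp_apply, hx]
  have h2 : RingHom.ker (f ^ n) = RingHom.ker (f ^ (n + 1)) := hn (n + 1) n.le_succ
  rw [← h2, RingHom.mem_ker] at h1
  exact h1

variable (N : ℕ)

/-- The substitution of the stars for the variables. -/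
noncomputable def starHom : MvPolynomial (Fin (N + 1)) ℚ →ₐ[ℚ] MvPolynomial (Fin (N + 1)) ℚ :=
  aeval fun k => starPoly N k

lemma starPoly_mem_range {k : ℕ} (hk : k ≤ N) : starPoly N k ∈ (starHom N).range :=
  ⟨X ⟨k, by omega⟩, by simp [starHom]⟩

/-- Each step of the reduction trades a power of `x` for one more factor `p - x`; the bound on `b +
L` ensures that only the available stars occur. For `L = 0` this yields the power sums. -/
lemma sum_pow_mul_pow_mem_range (b L : ℕ) (h : b + L ≤ N) :
    ∑ i : Fin (N + 1), X i ^ (b + 1) * (∑ j, X j - X i) ^ L ∈ (starHom N).range := by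
  induction b generalizing L with
  | zero => simpa [starPoly] using starPoly_mem_range N (k := L) (by omega)
  | succ b ih =>
    have e : ∑ i : Fin (N + 1), (X i : MvPolynomial (Fin (N + 1)) ℚ) ^ (b + 1 + 1) *
        (∑ j, X j - X i) ^ L = starPoly N 0 *
          (∑ i : Fin (N + 1), X i ^ (b + 1) * (∑ j, X j - X i) ^ L) -
        ∑ i : Fin (N + 1), X i ^ (b + 1) * (∑ j, X j - X i) ^ (L + 1) := by
      simp only [starPoly, pow_zero, mul_one]
      rw [Finset.mul_sum, ← Finset.sum_sub_distrib]
      refine Finset.sum_congr rfl fun i _ => ?_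
      ring
    rw [e]
    exact sub_mem (mul_mem (starPoly_mem_range N (Nat.zero_le _)) (ih L (by omega)))
      (ih (L + 1) (by omega))

lemma psum_mem_range {k : ℕ} (h0 : 0 < k) (hk : k ≤ N + 1) :
    psum (Fin (N + 1)) ℚ k ∈ (starHom N).range := by
  obtain ⟨b, rfl⟩ := Nat.exists_eq_succ_of_ne_zero h0.ne'
  simpa [psum] using sum_pow_mul_pow_mem_range N b 0 (by omega)

/-- Newton's identities express `k e_k` through power sums and smaller `e_j`, and `k` is invertible
in `ℚ`. -/
lemma esymm_mem_range (k : ℕ) (hk : k ≤ N + 1) :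
    esymm (Fin (N + 1)) ℚ k ∈ (starHom N).range := by
  induction k using Nat.strong_induction_on with
  | _ k ih =>
    rcases Nat.eq_zero_or_pos k with rfl | h0
    · rw [esymm_zero]
      exact one_mem _
    · have h := mul_esymm_eq_sum (Fin (N + 1)) ℚ k
      have h1 : (k : MvPolynomial (Fin (N + 1)) ℚ) * esymm (Fin (N + 1)) ℚ k ∈
          (starHom N).range := by
        rw [h]
        refine mul_mem (pow_mem (neg_mem (one_mem _)) _) (sum_mem fun a ha => ?_)
        rw [mem_filter, HasAntidiagonal.mem_antidiagonal] at ha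
        exact mul_mem (mul_mem (pow_mem (neg_mem (one_mem _)) _) (ih _ ha.2 (by omega)))
          (psum_mem_range N (by omega) (by omega))
      have h2 : esymm (Fin (N + 1)) ℚ k = C ((k : ℚ)⁻¹) *
          ((k : MvPolynomial (Fin (N + 1)) ℚ) * esymm (Fin (N + 1)) ℚ k) := by
        rw [← mul_assoc, ← map_natCast (C : ℚ →+* MvPolynomial (Fin (N + 1)) ℚ), ← C_mul,
          inv_mul_cancel₀ (by positivity), C_1, one_mul]
      rw [h2]
      exact mul_mem (Subalgebra.algebraMap_mem _ _) h1

lemma isSymmetric_starPoly (k : ℕ) : (starPoly N k).IsSymmetric := by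
  intro σ
  simp only [starPoly, map_sum, map_mul, map_pow, map_sub, rename_X]
  rw [Equiv.sum_comp σ fun j => (X j : MvPolynomial (Fin (N + 1)) ℚ)]
  exact Equiv.sum_comp σ fun i => (X i : MvPolynomial (Fin (N + 1)) ℚ) * (∑ j, X j - X i) ^ k

/-- The stars on at most `N + 1` vertices are algebraically independent. -/
lemma starHom_injective : Function.Injective (starHom N) := by
  have hcard : Fintype.card (Fin (N + 1)) = N + 1 := Fintype.card_fin _
  let ψ := esymmAlgEquiv (Fin (N + 1)) ℚ hcard
  let h : MvPolynomial (Fin (N + 1)) ℚ →ₐ[ℚ] MvPolynomial (Fin (N + 1)) ℚ :=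
    aeval fun k => ψ.symm ⟨starPoly N k, isSymmetric_starPoly N k⟩
  have hcomp : ∀ z, starHom N z = ψ (h z) := by
    intro z
    have : starHom N = ((symmetricSubalgebra (Fin (N + 1)) ℚ).val.comp
        (ψ : MvPolynomial (Fin (N + 1)) ℚ →ₐ[ℚ] _)).comp h := by
      refine algHom_ext fun k => ?_
      simp [starHom, h]
    rw [this]
    rfl
  have hrange : ∀ y, (ψ y : MvPolynomial (Fin (N + 1)) ℚ) ∈ (starHom N).range := by
    intro y
    induction y using MvPolynomial.induction_on with
    | C a =>
      have : (ψ (C a) : MvPolynomial (Fin (N + 1)) ℚ) = C a := by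
        have := ψ.commutes a
        rw [algebraMap_eq] at this
        rw [this]
        rfl
      rw [this]
      exact Subalgebra.algebraMap_mem _ a
    | add p q hp hq =>
      rw [map_add]
      exact add_mem hp hq
    | mul_X p i hp =>
      rw [map_mul]
      refine mul_mem hp ?_
      have : (ψ (X i) : MvPolynomial (Fin (N + 1)) ℚ) = esymm (Fin (N + 1)) ℚ (i + 1) := by
        simp [ψ, esymmAlgEquiv_apply, esymmAlgHom_apply]
      rw [this]
      exact esymm_mem_range N _ (by omega)
  -- Under the identification `ψ` of the symmetric polynomials with a polynomial ring, `starHom`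
  -- becomes an endomorphism `h`. It is surjective because the stars generate every elementary
  -- symmetric polynomial.
  have hsurj : Function.Surjective h := by
    intro y
    obtain ⟨z, hz⟩ := hrange y
    refine ⟨z, ψ.injective (Subtype.ext ?_)⟩
    rw [← hz]
    exact (hcomp z).symm
  have hinj := injective_of_surjective_ringHom h.toRingHom hsurj
  intro x y hxy
  rw [hcomp, hcomp] at hxy
  exact hinj (ψ.injective (Subtype.ext hxy))

lemma eq_zero_of_aeval_starPoly {Ψ : MvPolynomial ℕ ℚ} (h : ∀ N, aeval (starPoly N) Ψ = 0) :
    Ψ = 0 := by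
  -- Only finitely many variables occur in `Ψ`, so one large `N` suffices.
  obtain ⟨N, q, rfl⟩ : ∃ N, ∃ q : MvPolynomial (Fin (N + 1)) ℚ, rename Fin.val q = Ψ :=
    ⟨_, exists_rename_eq_of_vars_subset_range Ψ (Fin.val : Fin (Ψ.vars.sup id + 1) → ℕ)
      Fin.val_injective fun i hi => ⟨⟨i, Nat.lt_succ_of_le (Finset.le_sup (f := id) hi)⟩, rfl⟩⟩
  have h0 := h N
  rw [aeval_rename] at h0
  rw [starHom_injective N (h0.trans (map_zero _).symm), map_zero]

end Independence

/-! ### From power series to polynomials, and uniqueness of the expansion. -/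

section PowerSeries

open MvPolynomial

variable {V : Type*} [Fintype V] [DecidableEq V]

lemma weightedSum_one_zero (G : SimpleGraph V) (N : ℕ) :
    weightedSum G (fun _ => 1) (fun _ => 0) N = colorSum G fun _ i => X i := by
  rw [weightedSum]
  congr 1
  funext u i
  simp [vertexWeight]

/-- The substitution of zero for all variables but the first `N + 1`. -/
noncomputable def truncVars (N : ℕ) : MvPowerSeries ℕ ℚ →ₐ[ℚ] MvPowerSeries (Fin (N + 1)) ℚ :=
  MvPowerSeries.killCompl Fin.valEmbedding

lemma truncVars_csf (G : SimpleGraph V) (N : ℕ) :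
    truncVars N (csf G) = (weightedSum G (fun _ => 1) (fun _ => 0) N : MvPowerSeries _ ℚ) := by
  classical
  ext d
  rw [weightedSum_one_zero, truncVars, MvPowerSeries.coeff_killCompl, coeff_coe, colorSum,
    coeff_sum]
  have h1 : ∀ κ : V → Fin (N + 1), coeff d
      (if IsProper G κ then ∏ u, (X (κ u) : MvPolynomial (Fin (N + 1)) ℚ) else 0) =
      if IsProper G κ ∧ ∑ u, Finsupp.single (κ u) 1 = d then 1 else 0 := by
    intro κ
    have : ∏ u, (X (κ u) : MvPolynomial (Fin (N + 1)) ℚ) =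
        monomial (∑ u, Finsupp.single (κ u) 1) 1 := by
      rw [monomial_sum_one]
      rfl
    rw [this]
    by_cases h : IsProper G κ
    · simp [h, coeff_monomial]
    · simp [h]
  simp_rw [h1]
  rw [Finset.sum_boole, ← Fintype.card_subtype, ← Nat.card_eq_fintype_card]
  change (Nat.card _ : ℚ) = _
  congr 1
  have hsum : ∀ κ : V → Fin (N + 1), ∑ u, Finsupp.single (κ u : ℕ) 1 =
      Finsupp.embDomain Fin.valEmbedding (∑ u, Finsupp.single (κ u) 1) := by
    intro κ
    rw [Finsupp.embDomain_eq_mapDomain, Finsupp.mapDomain_finsetSum]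
    simp
  let f : {κ : V → Fin (N + 1) // IsProper G κ ∧ ∑ u, Finsupp.single (κ u) 1 = d} →
      {κ : G.Coloring ℕ // ∑ u, Finsupp.single (κ u) 1 = Finsupp.embDomain Fin.valEmbedding d} :=
    fun κ => ⟨SimpleGraph.Coloring.mk (fun u => (κ.1 u : ℕ))
      fun {u w} h e => κ.2.1 u w h (Fin.ext e), (hsum κ.1).trans (by rw [κ.2.2])⟩
  refine (Nat.card_congr (Equiv.ofBijective f ⟨?_, ?_⟩)).symm
  · intro κ κ' h
    ext u
    exact congrArg (fun c => c.1 u) h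
  · rintro ⟨κ, hκ⟩
    -- Every colour used appears in the exponent of the monomial, which involves only the first `N +
    -- 1` variables.
    have hlt : ∀ u, κ u < N + 1 := by
      intro u
      have h2 : κ u ∈ (Finsupp.embDomain Fin.valEmbedding d).support := by
        rw [← hκ, Finsupp.mem_support_iff, Finsupp.finsetSum_apply]
        have := Finset.single_le_sum (f := fun w => (Finsupp.single (κ w) 1 : ℕ →₀ ℕ) (κ u))
          (fun _ _ => Nat.zero_le _) (mem_univ u)
        simp only [Finsupp.single_eq_same] at this
        omega
      rw [Finsupp.support_embDomain, mem_map] at h2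
      obtain ⟨i, -, hi⟩ := h2
      rw [← hi]
      exact i.2
    refine ⟨⟨fun u => ⟨κ u, hlt u⟩, fun u w h e => κ.valid h (Fin.ext_iff.1 e), ?_⟩, ?_⟩
    · apply Finsupp.embDomain_injective Fin.valEmbedding
      rw [← hsum, ← hκ]
    · rfl

lemma eq_of_truncVars {f g : MvPowerSeries ℕ ℚ} (h : ∀ N, truncVars N f = truncVars N g) :
    f = g := by
  ext d
  have hd : (d.support : Set ℕ) ⊆
      Set.range (Fin.valEmbedding : Fin (d.support.sup id + 1) ↪ ℕ) := fun i hi =>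
    ⟨⟨i, Nat.lt_succ_of_le (Finset.le_sup (f := id) hi)⟩, rfl⟩
  have := congrArg (MvPowerSeries.coeff (d.comapDomain _ Fin.valEmbedding.injective.injOn))
    (h (d.support.sup id))
  rwa [truncVars, MvPowerSeries.coeff_killCompl, MvPowerSeries.coeff_killCompl,
    Finsupp.embDomain_comapDomain hd] at this

lemma starOn_adj {k : ℕ} (i j : Fin k) :
    (starOn k).Adj i j ↔ i ≠ j ∧ ((i : ℕ) = 0 ∨ (j : ℕ) = 0) := by
  rw [starOn, SimpleGraph.fromRel_adj]

lemma truncVars_csf_starOn (N k : ℕ) :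
    truncVars N (csf (starOn (k + 1))) = (starPoly N k : MvPowerSeries _ ℚ) := by
  rw [truncVars_csf, (weightedSum_isolate _ N (univ.erase 0) ?_).1]
  · have hbot : isolate (starOn (k + 1)) (univ.erase 0) = ⊥ := by
      ext i j
      simp only [isolate, SimpleGraph.bot_adj, iff_false, mem_erase, mem_univ, and_true, not_not]
      rintro ⟨h, rfl, rfl⟩
      exact h.ne rfl
    have hnbr : ((starOn (k + 1)).neighborSet 0 ∩ (univ.erase 0 : Finset (Fin (k + 1)))).ncard =
        k := by
      have : (starOn (k + 1)).neighborSet 0 ∩ (univ.erase 0 : Finset (Fin (k + 1))) =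
          (univ.erase 0 : Finset (Fin (k + 1))) := by
        ext i
        simp [starOn_adj, eq_comm]
      rw [this, Set.ncard_coe_finset, card_erase_of_mem (mem_univ _), card_univ, Fintype.card_fin,
        Nat.add_sub_cancel]
    rw [hbot, weightedSum, colorSum_bot, Fin.prod_univ_succ, Finset.prod_eq_one, mul_one]
    · simp only [vertexWeight, hnbr, starPoly]
      simp
    · intro i _
      simp [vertexWeight, Fin.succ_ne_zero]
  · intro i hi
    refine ⟨0, fun j => ?_, by simp⟩
    rw [starOn_adj]
    have hi0 : i ≠ 0 := (mem_erase.1 hi).1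
    constructor
    · rintro ⟨-, h | h⟩
      exacts [(hi0 (Fin.ext h)).elim, Fin.ext h]
    · rintro rfl
      exact ⟨hi0, Or.inr rfl⟩

variable {n : ℕ}

/-- The exponent vector of the star-basis element of a partition; the variable with index `k`
stands for the star on `k + 1` vertices. -/
noncomputable def starExponent (μ : n.Partition) : ℕ →₀ ℕ := (μ.parts.map fun k => k - 1).toFinsupp

lemma map_succ_starExponent (μ : n.Partition) :
    (Finsupp.toMultiset (starExponent μ)).map (· + 1) = μ.parts := by
  rw [starExponent, Multiset.toFinsupp_toMultiset, Multiset.map_map]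
  refine (Multiset.map_congr rfl fun k hk => ?_).trans (Multiset.map_id _)
  exact Nat.sub_add_cancel (μ.parts_pos hk)

lemma starExponent_injective : Function.Injective (starExponent (n := n)) := by
  intro μ ν h
  ext1
  rw [← map_succ_starExponent, h, map_succ_starExponent]

lemma weight_eq_sum (d : ℕ →₀ ℕ) :
    Finsupp.weight (fun k : ℕ => k + 1) d = ((Finsupp.toMultiset d).map (· + 1)).sum := by
  induction d using Finsupp.induction_linear with
  | zero => simp
  | add f g hf hg => simp [hf, hg]
  | single a b => simp [Finsupp.weight_apply, Finsupp.sum_single_index, Multiset.map_nsmul,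
      Multiset.sum_nsmul]

lemma exists_starExponent {d : ℕ →₀ ℕ} (hd : Finsupp.weight (fun k : ℕ => k + 1) d = n) :
    ∃ μ : n.Partition, starExponent μ = d := by
  refine ⟨⟨(Finsupp.toMultiset d).map (· + 1), ?_, ?_⟩, ?_⟩
  · intro i hi
    obtain ⟨k, -, rfl⟩ := Multiset.mem_map.1 hi
    exact k.succ_pos
  · rw [← weight_eq_sum, hd]
  · rw [starExponent, Multiset.map_map]
    simp

/-- The polynomial in the stars with given coefficients. -/
noncomputable def starPolynomial (a : n.Partition → ℚ) : MvPolynomial ℕ ℚ :=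
  ∑ μ, monomial (starExponent μ) (a μ)

lemma coeff_starPolynomial (a : n.Partition → ℚ) (μ : n.Partition) :
    coeff (starExponent μ) (starPolynomial a) = a μ := by
  classical
  rw [starPolynomial, coeff_sum, Finset.sum_eq_single μ]
  · simp
  · intro ν _ hν
    rw [coeff_monomial, if_neg fun h => hν (starExponent_injective h)]
  · simp

lemma eq_starPolynomial {Φ : MvPolynomial ℕ ℚ} (hΦ : Φ.IsWeightedHomogeneous (fun k => k + 1) n) :
    Φ = starPolynomial fun μ : n.Partition => coeff (starExponent μ) Φ := by
  classical
  ext d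
  by_cases h : coeff d Φ = 0
  · rw [h, starPolynomial, coeff_sum, Finset.sum_eq_zero]
    intro μ _
    rw [coeff_monomial]
    split_ifs with h'
    · rw [h', h]
    · rfl
  · obtain ⟨μ, rfl⟩ := exists_starExponent (hΦ h)
    rw [coeff_starPolynomial]

lemma truncVars_starBasis (N : ℕ) (μ : n.Partition) :
    truncVars N (starBasis μ) =
      (aeval (starPoly N) (monomial (starExponent μ) (1 : ℚ)) : MvPowerSeries _ ℚ) := by
  have h1 : aeval (starPoly N) (monomial (starExponent μ) (1 : ℚ)) =
      ((Finsupp.toMultiset (starExponent μ)).map (starPoly N)).prod := by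
    rw [aeval_monomial, map_one, one_mul, Finsupp.toMultiset_map, Finsupp.prod_toMultiset,
      Finsupp.prod_mapDomain_index (by simp) (by simp [pow_add])]
  rw [h1, starBasis, ← map_succ_starExponent, Multiset.map_map, map_multiset_prod,
    Multiset.map_map, ← coeToMvPowerSeries.ringHom_apply, map_multiset_prod, Multiset.map_map]
  congr 1
  refine Multiset.map_congr rfl fun k _ => ?_
  simp [truncVars_csf_starOn]

lemma truncVars_sum_starBasis (N : ℕ) (a : n.Partition → ℚ) :
    truncVars N (∑ μ, a μ • starBasis μ) =
      (aeval (starPoly N) (starPolynomial a) : MvPowerSeries _ ℚ) := by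
  rw [map_sum, starPolynomial, map_sum, ← coeToMvPowerSeries.ringHom_apply, map_sum]
  refine Finset.sum_congr rfl fun μ _ => ?_
  rw [map_smul, truncVars_starBasis, coeToMvPowerSeries.ringHom_apply]
  have : (monomial (starExponent μ) (a μ) : MvPolynomial ℕ ℚ) =
      a μ • monomial (starExponent μ) 1 := by rw [smul_monomial, smul_eq_mul, mul_one]
  rw [this, map_smul, MvPolynomial.coe_smul]

lemma isStarExpansion_iff (G : SimpleGraph V) (a : n.Partition → ℚ) :
    IsStarExpansion (csf G) a ↔ ∀ N, aeval (starPoly N) (starPolynomial a) =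
      weightedSum G (fun _ => 1) (fun _ => 0) N := by
  constructor
  · intro h N
    have := congrArg (truncVars N) h
    rw [truncVars_csf, truncVars_sum_starBasis] at this
    exact (coe_injective _ _ this).symm
  · intro h
    refine eq_of_truncVars fun N => ?_
    rw [truncVars_csf, truncVars_sum_starBasis, h]

/-- A star expansion of a chromatic symmetric function is unique. -/
lemma IsStarExpansion.unique {G : SimpleGraph V} {a a' : n.Partition → ℚ}
    (h : IsStarExpansion (csf G) a) (h' : IsStarExpansion (csf G) a') : a = a' := by
  rw [isStarExpansion_iff] at h h'
  have h0 : starPolynomial a - starPolynomial a' = 0 :=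
    eq_zero_of_aeval_starPoly fun N => by rw [map_sub, h, h', sub_self]
  funext μ
  rw [← coeff_starPolynomial a, sub_eq_zero.1 h0, coeff_starPolynomial]

end PowerSeries

/-! ### The exponent `B ^ k - 1` encodes the lexicographic order. -/

section Lexicographic

/-- The number encoding the position of a list of parts in the lexicographic order. -/
def listWeight (B : ℕ) (l : List ℕ) : ℕ := (l.map fun k => lexWeight B (k - 1)).sum

lemma listWeight_le {B b : ℕ} (hB : 2 ≤ B) {l : List ℕ} (h : ∀ k ∈ l, k ≤ b) :
    listWeight B l ≤ l.length * lexWeight B (b - 1) := by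
  induction l with
  | nil => simp [listWeight]
  | cons a l ih =>
    have h1 := ih fun k hk => h k (List.mem_cons_of_mem _ hk)
    have h2 := (lexWeight_strictMono hB).monotone
      (Nat.sub_le_sub_right (h a List.mem_cons_self) 1)
    simp only [listWeight, List.map_cons, List.sum_cons, List.length_cons] at *
    rw [add_mul, one_mul]
    omega

lemma length_le_sum {l : List ℕ} (h : ∀ k ∈ l, 0 < k) : l.length ≤ l.sum := by
  induction l with
  | nil => simp
  | cons a l ih =>
    have h1 := ih fun k hk => h k (List.mem_cons_of_mem _ hk)
    have h2 := h a List.mem_cons_self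
    simp only [List.length_cons, List.sum_cons]
    omega

/-- Fewer than `B` parts, all at most `a`, weigh at most `(B - 1) (B ^ (a-1) - 1) < B ^ a - 1`,
while the single part `b > a` already weighs at least `B ^ a - 1`. -/
lemma listWeight_lt {B : ℕ} (hB : 2 ≤ B) {a b : ℕ} {l₁ l₂ : List ℕ} (hab : a < b) (ha : 0 < a)
    (hle : ∀ k ∈ l₁, k ≤ a) (hlen : l₁.length + 1 < B) :
    listWeight B (a :: l₁) < listWeight B (b :: l₂) := by
  have h1 : listWeight B (a :: l₁) ≤ (l₁.length + 1) * lexWeight B (a - 1) :=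
    listWeight_le hB (l := a :: l₁) (b := a) (by simpa using hle)
  have h2 : lexWeight B a ≤ listWeight B (b :: l₂) := by
    have := (lexWeight_strictMono hB).monotone (show a ≤ b - 1 by omega)
    simp only [listWeight, List.map_cons, List.sum_cons]
    omega
  have h3 : (l₁.length + 1) * lexWeight B (a - 1) ≤ (B - 1) * lexWeight B (a - 1) :=
    Nat.mul_le_mul_right _ (by omega)
  have h4 : (B - 1) * lexWeight B (a - 1) < lexWeight B a := by
    obtain ⟨c, rfl⟩ := Nat.exists_eq_add_of_le hB
    obtain ⟨d, rfl⟩ := Nat.exists_eq_succ_of_ne_zero ha.ne'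
    have hpos : 0 < (2 + c) ^ d := by positivity
    obtain ⟨e, he⟩ := Nat.exists_eq_add_of_le hpos
    simp only [lexWeight, Nat.succ_eq_add_one, Nat.add_sub_cancel, pow_succ, he]
    rw [show 2 + c - 1 = 1 + c by omega, show 0 + 1 + e - 1 = e by omega]
    have e1 : (1 + c) * e = e + c * e := by ring
    have e2 : (0 + 1 + e) * (2 + c) = 2 + c + 2 * e + c * e := by ring
    rw [e1, e2]
    omega
  omega

/-- Equal sums of positive parts exclude proper prefixes, so the first differing part decides both
orders. The sum bounds the number of parts, as `listWeight_lt` needs. -/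
lemma lex_trichotomy {B : ℕ} (hB : 2 ≤ B) {l₁ l₂ : List ℕ} (hs₁ : l₁.Pairwise (· ≥ ·))
    (hs₂ : l₂.Pairwise (· ≥ ·)) (hp₁ : ∀ k ∈ l₁, 0 < k) (hp₂ : ∀ k ∈ l₂, 0 < k)
    (hsum : l₁.sum = l₂.sum) (hlt : l₁.sum < B) :
    l₁ = l₂ ∨ (List.Lex (· < ·) l₁ l₂ ∧ listWeight B l₁ < listWeight B l₂) ∨
      (List.Lex (· < ·) l₂ l₁ ∧ listWeight B l₂ < listWeight B l₁) := by
  induction l₁ generalizing l₂ with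
  | nil =>
    cases l₂ with
    | nil => exact Or.inl rfl
    | cons b l₂ =>
      have := hp₂ b List.mem_cons_self
      simp at hsum
      omega
  | cons a l₁ ih =>
    have ha := hp₁ a List.mem_cons_self
    cases l₂ with
    | nil =>
      simp at hsum
      omega
    | cons b l₂ =>
      have hb := hp₂ b List.mem_cons_self
      have hlen₁ := length_le_sum hp₁
      have hlen₂ := length_le_sum hp₂
      rw [List.length_cons] at hlen₁ hlen₂
      rw [List.pairwise_cons] at hs₁ hs₂
      rcases lt_trichotomy a b with h | rfl | h
      · exact Or.inr (Or.inl ⟨.rel h, listWeight_lt hB h ha hs₁.1 (by omega)⟩)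
      · simp only [List.sum_cons] at hsum hlt
        rcases ih hs₁.2 hs₂.2 (fun k hk => hp₁ k (List.mem_cons_of_mem _ hk))
          (fun k hk => hp₂ k (List.mem_cons_of_mem _ hk)) (by omega) (by omega) with
          h | ⟨h, h'⟩ | ⟨h, h'⟩
        · exact Or.inl (by rw [h])
        · refine Or.inr (Or.inl ⟨.cons h, ?_⟩)
          simp only [listWeight, List.map_cons, List.sum_cons] at *
          omega
        · refine Or.inr (Or.inr ⟨.cons h, ?_⟩)
          simp only [listWeight, List.map_cons, List.sum_cons] at *
          omega
      · exact Or.inr (Or.inr ⟨.rel h, listWeight_lt hB h hb hs₂.1 (by omega)⟩)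

variable {n B : ℕ}

/-- The number encoding the position of a partition in the lexicographic order. -/
def partitionWeight (B : ℕ) (μ : n.Partition) : ℕ :=
  (μ.parts.map fun k => lexWeight B (k - 1)).sum

lemma listWeight_sortedParts (μ : n.Partition) :
    listWeight B (sortedParts μ) = partitionWeight B μ := by
  rw [listWeight, partitionWeight, ← Multiset.sum_coe, ← Multiset.map_coe, sortedParts,
    Multiset.sort_eq]

lemma partition_trichotomy (hB : 2 ≤ B) (hn : n < B) (μ ν : n.Partition) :
    μ = ν ∨ (List.Lex (· < ·) (sortedParts μ) (sortedParts ν) ∧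
      partitionWeight B μ < partitionWeight B ν) ∨ partitionWeight B ν < partitionWeight B μ := by
  have hsum : ∀ μ : n.Partition, (sortedParts μ).sum = n := fun μ => by
    rw [← Multiset.sum_coe, sortedParts, Multiset.sort_eq, μ.parts_sum]
  have hpos : ∀ μ : n.Partition, ∀ k ∈ sortedParts μ, 0 < k := fun μ k hk =>
    μ.parts_pos ((Multiset.mem_sort _).1 hk)
  have h := lex_trichotomy hB (l₁ := sortedParts μ) (l₂ := sortedParts ν)
    (Multiset.pairwise_sort _ _) (Multiset.pairwise_sort _ _) (hpos μ) (hpos ν)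
    (by rw [hsum, hsum]) (by rwa [hsum])
  rw [listWeight_sortedParts, listWeight_sortedParts] at h
  rcases h with h | h | h
  · refine Or.inl (Nat.Partition.ext ?_)
    rw [← Multiset.sort_eq μ.parts (· ≥ ·), ← Multiset.sort_eq ν.parts (· ≥ ·)]
    exact congrArg _ h
  · exact Or.inr (Or.inl h)
  · exact Or.inr (Or.inr h.2)

open MvPolynomial in
lemma lexEval_starPolynomial (a : n.Partition → ℚ) :
    lexEval B (starPolynomial a) =
      ∑ μ, Polynomial.C (a μ) * Polynomial.X ^ partitionWeight B μ := by
  rw [starPolynomial, map_sum]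
  refine Finset.sum_congr rfl fun μ _ => ?_
  have h1 : partitionWeight B μ = ((Finsupp.toMultiset (starExponent μ)).map (lexWeight B)).sum := by
    rw [starExponent, Multiset.toFinsupp_toMultiset, Multiset.map_map]
    rfl
  rw [h1, lexEval, aeval_monomial, Polynomial.algebraMap_eq]
  congr 1
  induction starExponent μ using Finsupp.induction_linear with
  | zero => simp
  | add f g hf hg =>
    rw [Finsupp.prod_add_index' (by simp) (by simp [pow_add]), hf, hg, map_add, Multiset.map_add,
      Multiset.sum_add, pow_add]
  | single k c =>
    simp [Finsupp.prod_single_index, Multiset.map_nsmul, Multiset.sum_nsmul, ← pow_mul, mul_comm]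

variable {V : Type*} [Fintype V] [DecidableEq V]

/-- Distinct partitions have distinct weights, so no two coefficients collide under `lexEval`: the
lowest power of `t` that survives belongs to exactly one partition, the leading one. -/
theorem HasStarLead.exists_expansion (hB : 2 ≤ B) (hn : n < B) {G : SimpleGraph V} {m : ℕ} {α : ℚ}
    (h : HasStarLead B n (weightedSum G (fun _ => 1) fun _ => 0) m α) (hα : α ≠ 0) :
    ∃ a : n.Partition → ℚ, IsStarExpansion (csf G) a ∧
      ∃ μ, IsLeadingPartition a μ ∧ a μ = α := by
  obtain ⟨Φ, h1, h2, r, h3⟩ := h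
  set a : n.Partition → ℚ := fun μ => MvPolynomial.coeff (starExponent μ) Φ with ha
  have hΦ : Φ = starPolynomial a := eq_starPolynomial h1
  refine ⟨a, (isStarExpansion_iff G a).2 fun N => by rw [← hΦ, h2], ?_⟩
  rw [hΦ, lexEval_starPolynomial] at h3
  have hcoeff : ∀ μ, (∑ ν, Polynomial.C (a ν) * Polynomial.X ^ partitionWeight B ν).coeff
      (partitionWeight B μ) = a μ := by
    intro μ
    rw [Polynomial.finsetSum_coeff, Finset.sum_eq_single μ]
    · simp
    · intro ν _ hν
      rw [Polynomial.coeff_C_mul_X_pow, if_neg]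
      rcases partition_trichotomy hB hn μ ν with h | h | h
      exacts [fun _ => hν h.symm, h.2.ne, h.ne']
    · simp
  have hlow : ∀ μ, a μ ≠ 0 → m ≤ partitionWeight B μ := by
    intro μ hμ
    by_contra! hlt
    apply hμ
    rw [← hcoeff μ, h3, Polynomial.coeff_add, Polynomial.coeff_C_mul_X_pow, if_neg hlt.ne,
      Polynomial.coeff_X_pow_mul', if_neg (by omega), add_zero]
  have hm : (∑ ν, Polynomial.C (a ν) * Polynomial.X ^ partitionWeight B ν).coeff m = α := by
    rw [h3, Polynomial.coeff_add, Polynomial.coeff_C_mul_X_pow, if_pos rfl,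
      Polynomial.coeff_X_pow_mul', if_neg (by omega), add_zero]
  obtain ⟨μ, hμ⟩ : ∃ μ : n.Partition, partitionWeight B μ = m := by
    by_contra! hne
    apply hα
    rw [← hm, Polynomial.finsetSum_coeff, Finset.sum_eq_zero]
    intro ν _
    rw [Polynomial.coeff_C_mul_X_pow, if_neg (hne ν).symm]
  have haμ : a μ = α := by rw [← hcoeff μ, hμ, hm]
  refine ⟨μ, ⟨haμ ▸ hα, fun ν hν => ?_⟩, haμ⟩
  rcases partition_trichotomy hB hn μ ν with h | h | h
  · exact Or.inl h.symm
  · exact Or.inr h.1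
  · have := hlow ν hν
    omega

end Lexicographic

/-! ### The leading coefficient of a cycle with one tree. -/

section Unicyclic

variable {V : Type*} [Fintype V] [DecidableEq V]

lemma isDeep_iff (G : SimpleGraph V) [DecidableRel G.Adj] (u : V) :
    IsDeep G u ↔ 2 ≤ nbrCount G u ∧ ∀ x, G.Adj u x → nbrCount G x ≠ 1 := by
  simp only [IsDeep, nbrCount_eq_degree]

lemma exists_of_nbrCount_eq_one {G : SimpleGraph V} {u : V} (h : nbrCount G u = 1) :
    ∃ w, ∀ x, G.Adj u x ↔ x = w := by
  obtain ⟨w, hw⟩ := Set.ncard_eq_one.1 h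
  exact ⟨w, fun x => by rw [← SimpleGraph.mem_neighborSet, hw, Set.mem_singleton_iff]⟩

/-- `G` is connected and unicyclic, its cycle `C` has the vertices `a 0, …, a (k + 2)`, and only
the rooted tree at `a 0` is non-trivial. -/
structure IsCycleWithTree (G : SimpleGraph V) (C : G.Subgraph) (a : ℕ → V) (k : ℕ) : Prop where
  unicyclic : IsConnectedUnicyclic G C
  roots : nontrivialRoots G C = {a 0}
  injOn : Set.InjOn a (Set.Iic (k + 2))
  spanningCoe : C.spanningCoe = cycleOn a (k + 2)
  verts : C.verts = vertsOn a (k + 2)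

/-- The finite set of the leaves. -/
noncomputable def leafSet (G : SimpleGraph V) : Finset V := univ.filter fun u => nbrCount G u = 1

namespace IsCycleWithTree

variable {G : SimpleGraph V} {C : G.Subgraph} {a : ℕ → V} {k : ℕ}

lemma eq_iff (h : IsCycleWithTree G C a k) {i j : ℕ} (hi : i ≤ k + 2) (hj : j ≤ k + 2) :
    a i = a j ↔ i = j :=
  ⟨fun e => h.injOn (Set.mem_Iic.2 hi) (Set.mem_Iic.2 hj) e, fun e => e ▸ rfl⟩

lemma mem_verts (h : IsCycleWithTree G C a k) {x : V} : x ∈ C.verts ↔ x ∈ vertsOn a (k + 2) := by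
  rw [h.verts, Finset.mem_coe]

lemma mem_of_adj (h : IsCycleWithTree G C a k) {x y : V} (hxy : C.Adj x y) :
    x ∈ vertsOn a (k + 2) := h.mem_verts.1 (C.edge_vert hxy)

lemma adj_iff (h : IsCycleWithTree G C a k) {x y : V} :
    C.Adj x y ↔ (cycleOn a (k + 2)).Adj x y := by
  rw [← h.spanningCoe, SimpleGraph.Subgraph.spanningCoe_adj]

lemma ncard_neighborSet (h : IsCycleWithTree G C a k) {x : V} (hx : x ∈ vertsOn a (k + 2)) :
    (C.neighborSet x).ncard = 2 := by
  obtain ⟨u, q, hq, hC⟩ := h.unicyclic.isCycle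
  have hx' := h.mem_verts.2 hx
  rw [← hC] at hx' ⊢
  exact hq.ncard_neighborSet_toSubgraph_eq_two ((q.mem_verts_toSubgraph).1 hx')

lemma nbrCount_cycleOn (h : IsCycleWithTree G C a k) {x : V} (hx : x ∈ vertsOn a (k + 2)) :
    nbrCount (cycleOn a (k + 2)) x = 2 := by
  rw [nbrCount, ← h.spanningCoe]
  exact h.ncard_neighborSet hx

lemma adj_succ (h : IsCycleWithTree G C a k) {i : ℕ} (hi : i < k + 2) : C.Adj (a i) (a (i + 1)) := by
  rw [h.adj_iff]
  refine Or.inl ((pathOn_adj_iff fun j hj => ?_).2 ⟨i, hi, rfl⟩)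
  rw [Ne, h.eq_iff (by omega) (by omega)]
  omega

lemma adj_last (h : IsCycleWithTree G C a k) : C.Adj (a (k + 2)) (a 0) := by
  rw [h.adj_iff]
  refine Or.inr ((SimpleGraph.edge_adj ..).2 ⟨Or.inl ⟨rfl, rfl⟩, ?_⟩)
  rw [Ne, h.eq_iff le_rfl (by omega)]
  omega

lemma adj_of_mem (h : IsCycleWithTree G C a k) {x y : V} (hx : x ∈ vertsOn a (k + 2))
    (hx0 : x ≠ a 0) (hxy : G.Adj x y) : C.Adj x y :=
  adj_of_nontrivialRoots h.roots (h.mem_verts.2 hx) hx0 hxy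

lemma nbrCount_of_mem (h : IsCycleWithTree G C a k) {x : V} (hx : x ∈ vertsOn a (k + 2))
    (hx0 : x ≠ a 0) : nbrCount G x = 2 := by
  rw [← h.ncard_neighborSet hx, nbrCount]
  congr 1
  ext y
  exact ⟨fun hy => h.adj_of_mem hx hx0 hy, fun hy => C.adj_sub hy⟩

lemma three_le_nbrCount (h : IsCycleWithTree G C a k) : 3 ≤ nbrCount G (a 0) := by
  obtain ⟨-, x, hx, hxC⟩ := exists_adj_of_nontrivialRoots h.roots
  have h2 := h.ncard_neighborSet (mem_vertsOn (Nat.zero_le _))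
  have : (C.neighborSet (a 0)).ncard < (G.neighborSet (a 0)).ncard :=
    Set.ncard_lt_ncard ⟨fun y hy => C.adj_sub hy, fun hs => hxC (hs hx)⟩ (Set.toFinite _)
  rw [nbrCount]
  omega

lemma two_le_nbrCount_of_mem (h : IsCycleWithTree G C a k) {x : V} (hx : x ∈ vertsOn a (k + 2)) :
    2 ≤ nbrCount G x := by
  by_cases hx0 : x = a 0
  · rw [hx0]
    exact le_trans (by omega) h.three_le_nbrCount
  · exact (h.nbrCount_of_mem hx hx0).ge

lemma adj_last_iff (h : IsCycleWithTree G C a k) {x : V} :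
    G.Adj (a (k + 2)) x ↔ x = a 0 ∨ x = a (k + 1) := by
  have hne : a (k + 2) ≠ a 0 := by
    rw [Ne, h.eq_iff le_rfl (by omega)]
    omega
  have hne' : a 0 ≠ a (k + 1) := by
    rw [Ne, h.eq_iff (by omega) (by omega)]
    omega
  have hs : ({a 0, a (k + 1)} : Set V) = C.neighborSet (a (k + 2)) := by
    refine Set.eq_of_subset_of_ncard_le ?_ ?_ (Set.toFinite _)
    · rintro y (rfl | rfl)
      exacts [h.adj_last, (h.adj_succ (by omega)).symm]
    · rw [h.ncard_neighborSet (mem_vertsOn le_rfl), Set.ncard_pair hne']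
  constructor
  · intro hx
    have : x ∈ C.neighborSet (a (k + 2)) := h.adj_of_mem (mem_vertsOn le_rfl) hne hx
    rw [← hs] at this
    exact this
  · intro hx
    have : x ∈ C.neighborSet (a (k + 2)) := by
      rw [← hs]
      exact hx
    exact C.adj_sub this

lemma mem_leafSet {u : V} : u ∈ leafSet G ↔ nbrCount G u = 1 := by simp [leafSet]

lemma notMem_leafSet (h : IsCycleWithTree G C a k) {x : V} (hx : x ∈ vertsOn a (k + 2)) :
    x ∉ leafSet G := by
  rw [mem_leafSet]
  have := h.two_le_nbrCount_of_mem hx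
  omega

/-- Two adjacent leaves would form a whole connected component, without the cycle. -/
lemma leaf_neighbor (h : IsCycleWithTree G C a k) :
    ∀ ℓ ∈ leafSet G, ∃ w, (∀ x, G.Adj ℓ x ↔ x = w) ∧ w ∉ leafSet G := by
  intro ℓ hℓ
  obtain ⟨w, hw⟩ := exists_of_nbrCount_eq_one (mem_leafSet.1 hℓ)
  refine ⟨w, hw, fun hwL => ?_⟩
  obtain ⟨w', hw'⟩ := exists_of_nbrCount_eq_one (mem_leafSet.1 hwL)
  have hℓw' : ℓ = w' := (hw' ℓ).1 ((hw w).2 rfl).symm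
  have key : ∀ x y, G.Walk x y → (x = ℓ ∨ x = w) → (y = ℓ ∨ y = w) := by
    intro x y p
    induction p with
    | nil => exact id
    | cons hxy p ih =>
      rintro (rfl | rfl)
      · exact ih (Or.inr ((hw _).1 hxy))
      · exact ih (Or.inl (hℓw' ▸ (hw' _).1 hxy))
  obtain ⟨p⟩ := h.unicyclic.connected.preconnected ℓ (a 0)
  have h0 := h.notMem_leafSet (mem_vertsOn (Nat.zero_le _))
  rcases key _ _ p (Or.inl rfl) with e | e
  · exact h0 (e ▸ hℓ)
  · exact h0 (e ▸ hwL)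

/-- The number of leaves adjacent to a vertex. -/
noncomputable def leafNbrs (G : SimpleGraph V) (u : V) : ℕ := (G.neighborSet u ∩ leafSet G).ncard

lemma leafNbrs_eq_zero_iff {u : V} :
    leafNbrs G u = 0 ↔ ∀ x, G.Adj u x → nbrCount G x ≠ 1 := by
  rw [leafNbrs, Set.ncard_eq_zero, Set.eq_empty_iff_forall_notMem]
  simp [mem_leafSet]

/-- The rank is the distance from `a 0`. Edges off the cycle are bridges, and none of them meets the
cycle except at `a 0`. -/
lemma leafExt (h : IsCycleWithTree G C a k) :
    LeafExt (cycleOn a (k + 2)) (vertsOn a (k + 2)) (a 0) (isolate G (leafSet G)) := by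
  have hd0 : ∀ y, G.dist (a 0) y ≠ 0 → y ≠ a 0 := by
    rintro y hy rfl
    simp at hy
  refine leafExt_of_rank (G.dist (a 0)) (fun x y hxy => h.mem_of_adj (h.adj_iff.2 hxy)) _ ?_ ?_ ?_ ?_
  · intro x y hxy
    have hC := h.adj_iff.2 hxy
    exact ⟨C.adj_sub hC, h.notMem_leafSet (h.mem_of_adj hC),
      h.notMem_leafSet (h.mem_of_adj hC.symm)⟩
  · exact fun x y hxy hC => h.unicyclic.dist_ne _ hxy.1 fun h' => hC (h.adj_iff.1 h')
  · exact fun u x y hu hx hy hdx hdy => h.unicyclic.parent_unique _ hx.1 hy.1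
      (fun h' => hu (h.mem_of_adj h')) hdx hdy
  · intro x y hxy hC hd
    refine ⟨fun hy => hC ?_, fun hx => ?_⟩
    · exact (h.adj_iff.1 (h.adj_of_mem hy (hd0 y (by omega)) hxy.1.symm)).symm
    · by_contra hx0
      exact hC (h.adj_iff.1 (h.adj_of_mem hx hx0 hxy.1))

lemma admissible (h : IsCycleWithTree G C a k) :
    Admissible (vertsOn a (k + 2)) (a 0) (fun u => if u ∈ leafSet G then 0 else 1)
      (leafNbrs G) := by
  refine ⟨fun u hu => ?_, fun u hu hu0 => ⟨?_, ?_⟩, fun u hu => ?_⟩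
  · simp [h.notMem_leafSet hu]
  · simp [h.notMem_leafSet hu]
  · rw [leafNbrs_eq_zero_iff]
    intro x hx
    have := h.two_le_nbrCount_of_mem (h.mem_of_adj (h.adj_of_mem hu hu0 hx).symm)
    omega
  · have hu' : u ∈ leafSet G := by
      by_contra hu'
      simp [hu'] at hu
    obtain ⟨w, hw, hwL⟩ := h.leaf_neighbor u hu'
    rw [leafNbrs_eq_zero_iff]
    intro x hx
    rw [(hw x).1 hx]
    exact fun h' => hwL (mem_leafSet.2 h')

lemma nbrCount_isolate {u : V} (hu : u ∉ leafSet G) (h0 : leafNbrs G u = 0) :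
    nbrCount (isolate G (leafSet G)) u = nbrCount G u := by
  rw [leafNbrs_eq_zero_iff] at h0
  rw [nbrCount, nbrCount]
  congr 1
  ext x
  exact ⟨fun hx => hx.1, fun hx => ⟨hx, hu, fun h' => h0 x hx (mem_leafSet.1 h')⟩⟩

-- A vertex with no leaf as a neighbour is either deep, and keeps its degree when the leaves are
-- stripped, or is isolated afterwards and contributes `1 - 0`.
open scoped Classical in
lemma leadFactor_eq (S : Finset V) [DecidableRel G.Adj] (u : V) :
    leadFactor S (isolate G (leafSet G)) (leafNbrs G) u =
      if u ∉ S ∧ IsDeep G u then 1 - (nbrCount G u : ℚ) else 1 := by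
  rw [leadFactor]
  by_cases hu : u ∈ S
  · simp [hu]
  by_cases hdeep : IsDeep G u
  · have hd := (isDeep_iff G u).1 hdeep
    have h0 := leafNbrs_eq_zero_iff.2 hd.2
    have hL : u ∉ leafSet G := by
      rw [mem_leafSet]
      omega
    simp [hu, hdeep, h0, nbrCount_isolate hL h0]
  · simp only [hu, hdeep, not_false_eq_true, true_and, and_false, if_false]
    split_ifs with h0
    · have hlt : nbrCount G u < 2 := by
        by_contra hlt
        exact hdeep ((isDeep_iff G u).2 ⟨by omega, leafNbrs_eq_zero_iff.1 h0⟩)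
      rw [nbrCount_eq_zero, Nat.cast_zero, sub_zero]
      intro x hx
      by_cases h1 : nbrCount G u = 1
      · exact hx.2.1 (mem_leafSet.2 h1)
      · have h2 : nbrCount G u = 0 := by omega
        rw [nbrCount, Set.ncard_eq_zero] at h2
        have : x ∈ G.neighborSet u := hx.1
        rw [h2] at this
        exact this
    · rfl

/-- The contribution of the deep vertices off the cycle to the leading coefficient. -/
noncomputable def treeFactor (G : SimpleGraph V) (S : Finset V) : ℚ :=
  ∏ u, leadFactor S (isolate G (leafSet G)) (leafNbrs G) u

lemma treeFactor_ne_zero (S : Finset V) : treeFactor G S ≠ 0 := by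
  classical
  rw [treeFactor, Finset.prod_ne_zero_iff]
  intro u _
  rw [leadFactor_eq]
  split_ifs with h
  · have : (2 : ℚ) ≤ nbrCount G u := by exact_mod_cast ((isDeep_iff G u).1 h.2).1
    intro h0
    linarith
  · exact one_ne_zero

/-- The core is a cycle on `k + 3` vertices, with `E = (-1) ^ (k+1)` and `A = (-1) ^ k (k+1)`; the
subtracted 2 is the degree of `a 0` in it. -/
theorem hasStarLead (h : IsCycleWithTree G C a k) {B : ℕ} (hB : 2 ≤ B) :
    ∃ m, HasStarLead B (Fintype.card V) (weightedSum G (fun _ => 1) fun _ => 0) m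
      ((if leafNbrs G (a 0) = 0 then (-1) ^ k * (-1 - (k + 1) * ((nbrCount G (a 0) : ℚ) - 2))
        else (-1) ^ k * (k + 1)) * treeFactor G (vertsOn a (k + 2))) := by
  have h1 := h.leafExt.hasStarLead hB (mem_vertsOn (Nat.zero_le _))
    (fun u hu x hx => hu (h.mem_of_adj (h.adj_iff.2 hx)))
    (fun b L hbL => hasStarLead_cycleOn (k := k + 1) hB h.injOn hbL) h.admissible ?_
  · have h2 := fun N => weightedSum_isolate G N (leafSet G) h.leaf_neighbor
    refine ⟨_, h1.congr (h2 0).2 (fun N => (h2 N).1.symm) rfl ?_⟩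
    rw [treeFactor, h.nbrCount_cycleOn (mem_vertsOn (Nat.zero_le _))]
    split_ifs with h0
    · rw [nbrCount_isolate (h.notMem_leafSet (mem_vertsOn (Nat.zero_le _))) h0]
      push_cast
      ring
    · push_cast
      ring
  · intro u x hux
    simp [hux.2.1]

end IsCycleWithTree

end Unicyclic

/-! ### Deep vertices after deleting an edge of the cycle. -/

section DeletedEdge

namespace IsCycleWithTree

variable {V : Type*} [Fintype V] [DecidableEq V] {G : SimpleGraph V} {C : G.Subgraph} {a : ℕ → V}
  {k : ℕ}

/-- The graph `G` with the last edge of the cycle deleted. -/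
def cutGraph (G : SimpleGraph V) (a : ℕ → V) (k : ℕ) : SimpleGraph V :=
  G.deleteEdges {s(a 0, a (k + 2))}

lemma cutGraph_adj {x y : V} :
    (cutGraph G a k).Adj x y ↔ G.Adj x y ∧ s(x, y) ≠ s(a 0, a (k + 2)) := by
  rw [cutGraph, SimpleGraph.deleteEdges_adj, Set.mem_singleton_iff]

lemma nbrCount_cutGraph {u : V} (hu0 : u ≠ a 0) (hu : u ≠ a (k + 2)) :
    nbrCount (cutGraph G a k) u = nbrCount G u := by
  rw [nbrCount, nbrCount]
  congr 1
  ext x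
  rw [SimpleGraph.mem_neighborSet, SimpleGraph.mem_neighborSet, cutGraph_adj]
  refine and_iff_left fun he => ?_
  rw [Sym2.eq_iff] at he
  rcases he with ⟨h, -⟩ | ⟨h, -⟩
  exacts [hu0 h, hu h]

lemma ne_last (h : IsCycleWithTree G C a k) : a 0 ≠ a (k + 2) := by
  rw [Ne, h.eq_iff (by omega) le_rfl]
  omega

lemma nbrCount_cutGraph_zero (h : IsCycleWithTree G C a k) :
    nbrCount (cutGraph G a k) (a 0) + 1 = nbrCount G (a 0) := by
  have hs : G.neighborSet (a 0) = insert (a (k + 2)) ((cutGraph G a k).neighborSet (a 0)) := by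
    ext x
    rw [Set.mem_insert_iff, SimpleGraph.mem_neighborSet, SimpleGraph.mem_neighborSet, cutGraph_adj]
    constructor
    · intro hx
      by_cases hxl : x = a (k + 2)
      · exact Or.inl hxl
      · refine Or.inr ⟨hx, fun he => ?_⟩
        rw [Sym2.eq_iff] at he
        rcases he with ⟨-, e⟩ | ⟨e, -⟩
        exacts [hxl e, h.ne_last e]
    · rintro (rfl | hx)
      exacts [(C.adj_sub h.adj_last).symm, hx.1]
  rw [nbrCount, nbrCount, hs, Set.ncard_insert_of_notMem]
  rw [SimpleGraph.mem_neighborSet, cutGraph_adj]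
  exact fun hx => hx.2 rfl

lemma nbrCount_cutGraph_last (h : IsCycleWithTree G C a k) :
    nbrCount (cutGraph G a k) (a (k + 2)) = 1 := by
  rw [nbrCount, Set.ncard_eq_one]
  refine ⟨a (k + 1), ?_⟩
  have hne : a (k + 1) ≠ a 0 := by
    rw [Ne, h.eq_iff (by omega) (by omega)]
    omega
  ext x
  rw [SimpleGraph.mem_neighborSet, cutGraph_adj, Set.mem_singleton_iff, h.adj_last_iff]
  constructor
  · rintro ⟨rfl | hx, he⟩
    exacts [(he Sym2.eq_swap).elim, hx]
  · rintro rfl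
    refine ⟨Or.inr rfl, fun he => ?_⟩
    rw [Sym2.eq_iff] at he
    rcases he with ⟨e, -⟩ | ⟨-, e⟩
    exacts [h.ne_last e.symm, hne e]

lemma not_isDeep_last (h : IsCycleWithTree G C a k) [DecidableRel (cutGraph G a k).Adj] :
    ¬ IsDeep (cutGraph G a k) (a (k + 2)) := by
  rw [isDeep_iff, h.nbrCount_cutGraph_last]
  omega

lemma not_isDeep_succ (h : IsCycleWithTree G C a k) [DecidableRel (cutGraph G a k).Adj] :
    ¬ IsDeep (cutGraph G a k) (a (k + 1)) := by
  rw [isDeep_iff]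
  rintro ⟨-, hd⟩
  refine hd (a (k + 2)) (cutGraph_adj.2 ⟨C.adj_sub (h.adj_succ (by omega)), fun he => ?_⟩)
    h.nbrCount_cutGraph_last
  rw [Sym2.eq_iff, h.eq_iff (by omega) (by omega), h.eq_iff (by omega) (by omega),
    h.eq_iff (by omega) (by omega), h.eq_iff (by omega) (by omega)] at he
  omega

/-- The degree one vertices other than the new leaf are the same before and after the deletion. -/
lemma nbrCount_cutGraph_eq_one_iff (h : IsCycleWithTree G C a k) {x : V} (hx : x ≠ a (k + 2)) :
    nbrCount (cutGraph G a k) x = 1 ↔ nbrCount G x = 1 := by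
  by_cases hx0 : x = a 0
  · have h1 := h.nbrCount_cutGraph_zero
    have h2 := h.three_le_nbrCount
    rw [hx0]
    omega
  · rw [nbrCount_cutGraph hx0 hx]

/-- The cut creates a single new leaf `a (k + 2)`, whose only neighbour is `a (k + 1)`; `a 0` loses
one edge but had at least three. -/
lemma isDeep_cutGraph_iff (h : IsCycleWithTree G C a k) [DecidableRel G.Adj]
    [DecidableRel (cutGraph G a k).Adj] {u : V} (hu1 : u ≠ a (k + 1)) (hu2 : u ≠ a (k + 2)) :
    IsDeep (cutGraph G a k) u ↔ IsDeep G u := by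
  rw [isDeep_iff, isDeep_iff]
  refine and_congr ?_ (forall_congr' fun x => ?_)
  · by_cases hu0 : u = a 0
    · have h1 := h.nbrCount_cutGraph_zero
      have h2 := h.three_le_nbrCount
      rw [hu0]
      omega
    · rw [nbrCount_cutGraph hu0 hu2]
  · by_cases hx : x = a (k + 2)
    · have hG : nbrCount G x ≠ 1 := by
        rw [hx, h.nbrCount_of_mem (mem_vertsOn le_rfl) h.ne_last.symm]
        omega
      refine iff_of_true (fun hux => ?_) fun _ => hG
      have hxu := hux.symm
      rw [hx, cutGraph_adj, h.adj_last_iff] at hxu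
      rcases hxu with ⟨rfl | e, he⟩
      exacts [(he Sym2.eq_swap).elim, (hu1 e).elim]
    · rw [Ne, Ne, h.nbrCount_cutGraph_eq_one_iff hx, cutGraph_adj]
      have hs : s(u, x) ≠ s(a 0, a (k + 2)) := by
        intro he
        rw [Sym2.eq_iff] at he
        rcases he with ⟨-, e⟩ | ⟨e, -⟩
        exacts [hx e, hu2 e]
      simp [hs]

lemma isDeep_of_mem (h : IsCycleWithTree G C a k) [DecidableRel G.Adj] {j : ℕ} (h0 : 0 < j)
    (hj : j ≤ k + 2) : IsDeep G (a j) := by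
  have hne : a j ≠ a 0 := by
    rw [Ne, h.eq_iff hj (by omega)]
    omega
  rw [isDeep_iff]
  refine ⟨h.two_le_nbrCount_of_mem (mem_vertsOn hj), fun x hx => ?_⟩
  have := h.two_le_nbrCount_of_mem (h.mem_of_adj (h.adj_of_mem (mem_vertsOn hj) hne hx).symm)
  omega

/-- On the cycle, `a (k + 2)` is now a leaf and `a (k + 1)` is adjacent to it, so neither is deep.
The vertices `a 1, …, a k` are deep of degree two and give the sign; off the cycle nothing changes.
-/
theorem prod_deepVertices (h : IsCycleWithTree G C a k) [DecidableRel G.Adj]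
    [DecidableRel (cutGraph G a k).Adj] :
    ∏ u ∈ deepVertices (cutGraph G a k), (1 - ((cutGraph G a k).degree u : ℚ)) =
      (if IsDeep G (a 0) then 1 - ((cutGraph G a k).degree (a 0) : ℚ) else 1) *
        ((-1) ^ k * treeFactor G (vertsOn a (k + 2))) := by
  set S := vertsOn a (k + 2) with hS
  set f : V → ℚ := fun u => if IsDeep (cutGraph G a k) u
    then 1 - ((cutGraph G a k).degree u : ℚ) else 1 with hf
  have h1 : ∏ u ∈ deepVertices (cutGraph G a k), (1 - ((cutGraph G a k).degree u : ℚ)) =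
      ∏ u, f u := by
    rw [deepVertices, Finset.prod_filter]
  have h2 : ∏ u ∈ univ \ S, f u = treeFactor G S := by
    rw [treeFactor, ← Finset.prod_subset (Finset.subset_univ (univ \ S))]
    · refine Finset.prod_congr rfl fun u hu => ?_
      rw [mem_sdiff] at hu
      have hne : ∀ j, j ≤ k + 2 → u ≠ a j := by
        rintro j hj rfl
        exact hu.2 (mem_vertsOn hj)
      rw [leadFactor_eq]
      simp only [hf, h.isDeep_cutGraph_iff (hne _ (by omega)) (hne _ le_rfl), hu.2,
        not_false_eq_true, true_and, ← nbrCount_eq_degree,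
        nbrCount_cutGraph (hne 0 (by omega)) (hne _ le_rfl)]
    · intro u _ hu
      simp only [mem_sdiff, mem_univ, true_and, not_not] at hu
      rw [leadFactor_eq, if_neg fun h' => h'.1 hu]
  have h3 : ∏ u ∈ S, f u = f (a 0) * (-1) ^ k := by
    rw [hS, vertsOn, Finset.prod_image, Finset.prod_range_succ, Finset.prod_range_succ,
      Finset.prod_range_succ']
    · have e1 : f (a (k + 2)) = 1 := if_neg h.not_isDeep_last
      have e2 : f (a (k + 1)) = 1 := if_neg h.not_isDeep_succ
      have e3 : ∀ j ∈ range k, f (a (j + 1)) = -1 := by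
        intro j hj
        rw [mem_range] at hj
        have hne : ∀ i, i ≤ k + 2 → j + 1 ≠ i → a (j + 1) ≠ a i := fun i hi hij => by
          rwa [Ne, h.eq_iff (by omega) hi]
        have hn0 := hne 0 (by omega) (by omega)
        have hn1 := hne (k + 1) (by omega) (by omega)
        have hn2 := hne (k + 2) le_rfl (by omega)
        simp only [hf]
        rw [if_pos ((h.isDeep_cutGraph_iff hn1 hn2).2 (h.isDeep_of_mem (by omega) (by omega))),
          ← nbrCount_eq_degree, nbrCount_cutGraph hn0 hn2,
          h.nbrCount_of_mem (mem_vertsOn (by omega)) hn0]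
        norm_num
      rw [e1, e2, Finset.prod_congr rfl e3]
      simp [mul_comm]
    · intro i hi j hj hij
      rw [Finset.mem_coe, mem_range] at hi hj
      exact (h.eq_iff (by omega) (by omega)).1 hij
  have hn1 : a 0 ≠ a (k + 1) := by
    rw [Ne, h.eq_iff (by omega) (by omega)]
    omega
  rw [h1, ← Finset.prod_sdiff (Finset.subset_univ S), h2, h3]
  simp only [hf, h.isDeep_cutGraph_iff hn1 h.ne_last]
  ring

lemma isSprout_iff (h : IsCycleWithTree G C a k) [DecidableRel G.Adj] :
    IsSprout G C (a 0) ↔ IsDeep G (a 0) := by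
  refine ⟨fun h' => h'.2.1, fun h' => ⟨h.mem_verts.2 (mem_vertsOn (Nat.zero_le _)), h', ?_⟩⟩
  rw [← nbrCount_eq_degree]
  exact h.three_le_nbrCount

lemma isDeep_zero_iff (h : IsCycleWithTree G C a k) [DecidableRel G.Adj] :
    IsDeep G (a 0) ↔ leafNbrs G (a 0) = 0 := by
  rw [isDeep_iff, leafNbrs_eq_zero_iff]
  exact and_iff_right (h.two_le_nbrCount_of_mem (mem_vertsOn (Nat.zero_le _)))

lemma ncard_verts (h : IsCycleWithTree G C a k) : C.verts.ncard = k + 3 := by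
  rw [h.verts, Set.ncard_coe_finset, vertsOn, card_image_of_injOn, card_range]
  intro i hi j hj hij
  rw [Finset.mem_coe, mem_range] at hi hj
  exact (h.eq_iff (by omega) (by omega)).1 hij

end IsCycleWithTree

lemma neg_one_pow_card_mul_prod {ι : Type*} (s : Finset ι) (f : ι → ℚ) :
    (-1) ^ s.card * ∏ i ∈ s, (f i - 1) = ∏ i ∈ s, (1 - f i) := by
  rw [← Finset.prod_const, ← Finset.prod_mul_distrib]
  exact Finset.prod_congr rfl fun i _ => by ring

end DeletedEdge

end ChromSym

/-! ### Comparison with the stated formulas. -/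

theorem mainTheorem3 {V : Type*} [Fintype V] [DecidableEq V]
    (G : SimpleGraph V) [DecidableRel G.Adj]
    (C : G.Subgraph) (hG : ChromSym.IsConnectedUnicyclic G C)
    (v : V) (hv : ChromSym.nontrivialRoots G C = {v})
    (w : V) (hvw : C.Adj v w)
    (T' : SimpleGraph V) [DecidableRel T'.Adj] (hT' : T' = G.deleteEdges {s(v, w)})
    (p : ℕ) (hp : p = (ChromSym.deepVertices T').card)
    (c : ℕ) (hc : c = C.verts.ncard) :
    (∃! a : (Fintype.card V).Partition → ℚ, ChromSym.IsStarExpansion (ChromSym.csf G) a) ∧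
    ∀ a : (Fintype.card V).Partition → ℚ, ChromSym.IsStarExpansion (ChromSym.csf G) a →
      ∃ μ : (Fintype.card V).Partition, ChromSym.IsLeadingPartition a μ ∧
        (ChromSym.IsSprout G C v →
          v ∈ ChromSym.deepVertices T' ∧
          a μ = (-1) ^ p *
            (((c : ℚ) - 2) * ∏ u ∈ ChromSym.deepVertices T', ((T'.degree u : ℚ) - 1)
              + ∏ u ∈ (ChromSym.deepVertices T').erase v, ((T'.degree u : ℚ) - 1))) ∧
        (¬ ChromSym.IsSprout G C v →
          a μ = (-1) ^ p *
            (((c : ℚ) - 2) * ∏ u ∈ ChromSym.deepVertices T', ((T'.degree u : ℚ) - 1))) := by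
  obtain ⟨k, a, hinj, rfl, rfl, hcyc, hverts⟩ := ChromSym.exists_cycleOn hG.isCycle hvw
  have h : ChromSym.IsCycleWithTree G C a k := ⟨hG, hv, hinj, hcyc, hverts⟩
  obtain rfl : T' = ChromSym.IsCycleWithTree.cutGraph G a k := hT'
  set P := ChromSym.IsCycleWithTree.treeFactor G (ChromSym.vertsOn a (k + 2)) with hP
  have hP0 : P ≠ 0 := ChromSym.IsCycleWithTree.treeFactor_ne_zero _
  have hc2 : (c : ℚ) - 2 = k + 1 := by
    rw [hc, h.ncard_verts]
    push_cast
    ring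
  have hdeg : ((ChromSym.IsCycleWithTree.cutGraph G a k).degree (a 0) : ℚ) + 1 =
      ChromSym.nbrCount G (a 0) := by
    rw [← ChromSym.nbrCount_eq_degree]
    exact_mod_cast h.nbrCount_cutGraph_zero
  have hdeg3 : (3 : ℚ) ≤ ChromSym.nbrCount G (a 0) := by exact_mod_cast h.three_le_nbrCount
  have hk : (0 : ℚ) ≤ k := Nat.cast_nonneg k
  have hsign : ((-1 : ℚ) ^ k) ≠ 0 := pow_ne_zero _ (by norm_num)
  obtain ⟨m, hm⟩ := h.hasStarLead (B := Fintype.card V + 2) (by omega)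
  have hprod := h.prod_deepVertices
  rw [← hP] at hm hprod
  obtain ⟨a₀, ha₀, μ, hμ, haμ⟩ := hm.exists_expansion (by omega) (by omega) (by
    refine mul_ne_zero ?_ hP0
    split_ifs
    -- Since `a 0` has degree at least three, the bracket `-1 - (k + 1)(deg - 2)` is negative.
    · refine mul_ne_zero hsign (ne_of_lt ?_)
      have : 0 ≤ ((k : ℚ) + 1) * ((ChromSym.nbrCount G (a 0) : ℚ) - 2) :=
        mul_nonneg (by linarith) (by linarith)
      linarith
    · exact mul_ne_zero hsign (by positivity))
  refine ⟨⟨a₀, ha₀, fun b hb => hb.unique ha₀⟩, fun b hb => ?_⟩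
  obtain rfl : b = a₀ := hb.unique ha₀
  refine ⟨μ, hμ, fun hs => ?_, fun hs => ?_⟩
  · rw [h.isSprout_iff] at hs
    have hmem : a 0 ∈ ChromSym.deepVertices (ChromSym.IsCycleWithTree.cutGraph G a k) := by
      refine Finset.mem_filter.2 ⟨Finset.mem_univ _, (h.isDeep_cutGraph_iff ?_ h.ne_last).2 hs⟩
      rw [Ne, h.eq_iff (by omega) (by omega)]
      omega
    refine ⟨hmem, ?_⟩
    rw [if_pos hs] at hprod
    rw [if_pos (h.isDeep_zero_iff.1 hs)] at haμ
    have herase : ∏ u ∈ (ChromSym.deepVertices (ChromSym.IsCycleWithTree.cutGraph G a k)).erase (a 0),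
        (1 - ((ChromSym.IsCycleWithTree.cutGraph G a k).degree u : ℚ)) =
        (-1) ^ k * P := by
      rw [← Finset.mul_prod_erase _ _ hmem] at hprod
      -- The cancelled factor `1 - deg` at `a 0` is non-zero: its degree in the cut graph is at
      -- least two.
      exact mul_left_cancel₀ (by intro h0; linarith) hprod
    have hcard : p =
        ((ChromSym.deepVertices (ChromSym.IsCycleWithTree.cutGraph G a k)).erase (a 0)).card + 1 := by
      rw [hp, Finset.card_erase_add_one hmem]
    -- The second product has `p - 1` factors, so one sign is left over; it gives the summand `-1`
    -- in the leading coefficient.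
    rw [mul_add, mul_left_comm, hp, ChromSym.neg_one_pow_card_mul_prod, hprod, ← hp, hcard,
      pow_succ', mul_assoc, ChromSym.neg_one_pow_card_mul_prod, herase, haμ, hc2, ← hdeg]
    ring
  · rw [h.isSprout_iff] at hs
    rw [if_neg hs, one_mul] at hprod
    rw [if_neg fun h0 => hs (h.isDeep_zero_iff.2 h0)] at haμ
    rw [mul_left_comm, hp, ChromSym.neg_one_pow_card_mul_prod, hprod, haμ, hc2]
    ring
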